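/- Let $\Bbbk$ be a field of characteristic $0$. Let $\Lambda=\mathcal A_+(U(3))\oplus\Bbbk$ be the unital associative $\Bbbk$-algebra with generators $v(n)$, $n\ge 0$, and relations $$v(n)v(m)-3v(n-1)v(m+1)+3v(n-2)v(m+2)-v(n-3)v(m+3)=0\quad(n\ge 3,\ m\ge 0),$$ $$v(n)v(m)-v(m)v(n)=(n-m)\,v(n+m-1)\quad(n>m\ge 0),$$ augmented by $\varepsilon(v(n))=0$. Order the words in the $v(n)$ by the deg-lex order with $v(n)>v(m)$ iff $n>m$, and call a word *normal* if in $\Lambda$ it is not a linear combination of smaller words. The normal words form a basis of $\Lambda$. An *Anick chain* with $n$ entries is a tuple $[w_1|\dots|w_n]$ of non-empty normal words such that $w_1$ is a letter and, for each $i<n$, $w_iw_{i+1}$ is not normal while $w_ip$ is normal for every proper prefix $p$ of $w_{i+1}$ (for $n=0$: the empty tuple). Let $\Gamma$ be the weighted graph of the normalized two-sided bar resolution $\mathsf B_\bullet(\Lambda,\Lambda)$: its vertices are the tuples $[w_1|\dots|w_n]$ of non-empty normal words, and the weight in $\Lambda^e=\Lambda\otimes\Lambda^{op}$ of the edge $b\to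 c$ is the coefficient at $c$ of $$w_1[w_2|\dots|w_n]+\sum_{i=1}^{n-1}(-1)^i[w_1|\dots|w_iw_{i+1}|\dots|w_n]+(-1)^n[w_1|\dots|w_{n-1}]w_n ,\qquad b=[w_1|\dots|w_n],$$ where the products $w_iw_{i+1}$ are expanded in normal words and edges of zero weight are omitted. Match $[w_1|\dots|w_i|p|q|\dots|w_n]\to[w_1|\dots|w_i|w_{i+1}|\dots|w_n]$ whenever $w_{i+1}=pq$ with $p,q$ non-empty, $[w_1|\dots|w_i]$ is the longest initial segment of the second vertex that is an Anick chain, and $[w_1|\dots|w_i|p]$ is an Anick chain. In $\Gamma$ reverse every matched edge, replacing its weight $w$ by $-w^{-1}$. For Anick chains $b,a$ let $\Gamma(b,a)$ be the sum, over all paths from $b$ to $a$ in the resulting graph, of the products of the edge weights. The Anick resolution $\mathsf A_\bullet(\Lambda,\Lambda)$ has as its $n$th term the free $\Lambda^e$-module on the Anick chains with $n$ entries, with differential $b\mapsto\sum_a\Gamma(b,a)\,a$, and $\mathsf A_\bullet=\mathsf A_\bullet(\Lambda,\Lambda)\otimes_{\Lambda^e}\Bbbk$ (via $\varepsilon$)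 has differential $\mathrm d_{n+1}:\mathsf A_{n+1}\to\mathsf A_n$. **Theorem.** Only finitely many paths start at any given Anick chain. Let $n\ge 1$. Writing $[i_1|\dots|i_m]$ for $[v(i_1)|\dots|v(i_m)]$, the Anick chains with $n+1$ entries are exactly the tuples $[i_1|\dots|i_{n+1}]$ with $i_1,\dots,i_{n-1}\ge 2$ and either $i_n\ge 2$ or $(i_n,i_{n+1})=(1,0)$. Reading every tuple that is not an Anick chain as $0$, one has, for $i_1,\dots,i_n\ge 2$, $i_{n+1}\ge 0$, $$\begin{aligned} \mathrm d_{n+1}[i_1|\dots|i_{n+1}]={}&\sum_{j=1}^{n}(-1)^j\frac{i_j(i_j-1)}{i_j+i_{j+1}-1}\,[i_1|\dots|i_j+i_{j+1}-1|\dots|i_{n+1}]\\ &-\sum_{j=2}^{n}\sum_{t=1}^{j-1}(-1)^j\, i_t\,\frac{(i_j-1)(i_{j+1}-1)}{i_j+i_{j+1}-1}\,[i_1|\dots|i_t-1|\dots|i_j+i_{j+1}|\dots|i_{n+1}]\\ &+\sum_{j=2}^{n}\sum_{t=1}^{j-1}(-1)^j\frac{i_ji_{j+1}}{i_j+i_{j+1}-1}(i_t-1)\,[i_1|\dots|i_j+i_{j+1}-1|\dots|i_{n+1}],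 \end{aligned}$$ and, for $i_1,\dots,i_{n-1}\ge 2$, $$\begin{aligned} \mathrm d_{n+1}[i_1|\dots|i_{n-1}|1|0]={}&\sum_{j=1}^{n-2}(-1)^j\frac{i_j(i_j-1)}{i_j+i_{j+1}-1}\,[i_1|\dots|i_j+i_{j+1}-1|\dots|i_{n-1}|1|0]\\ &-\sum_{j=2}^{n-2}\sum_{t=1}^{j-1}(-1)^j\, i_t\,\frac{(i_j-1)(i_{j+1}-1)}{i_j+i_{j+1}-1}\,[i_1|\dots|i_t-1|\dots|i_j+i_{j+1}|\dots|i_{n-1}|1|0]\\ &+\sum_{j=2}^{n-2}\sum_{t=1}^{j-1}(-1)^j\frac{i_ji_{j+1}}{i_j+i_{j+1}-1}(i_t-1)\,[i_1|\dots|i_j+i_{j+1}-1|\dots|i_{n-1}|1|0]\\ &+\sum_{j=1}^{n-1}(-1)^n\, i_j\,[i_1|\dots|i_j-1|\dots|i_{n-1}|1] +\sum_{j=1}^{n-1}(-1)^{n-1}(i_j-1)\,[i_1|\dots|i_{n-1}|0]\\ &+(-1)^n[i_1|\dots|i_{n-1}|0]. \end{aligned}$$ -/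

import Mathlib

open scoped TensorProduct

namespace AnickU3

universe u

/-! ### The augmented algebra `Λ = A₊(U(3)) ⊕ k` -/

/-- The generator `v(n)` in the free associative algebra. -/
noncomputable abbrev fv (k : Type u) [Field k] (n : ℕ) : FreeAlgebra k ℕ := FreeAlgebra.ι k n

/-- The defining relations of `A₊(U(3))`: locality (with `n + 3` in place of `n ≥ 3`) and the
commutation relations of the Virasoro coefficient algebra. -/
inductive Rel (k : Type u) [Field k] : FreeAlgebra k ℕ → FreeAlgebra k ℕ → Prop
  | loc (n m : ℕ) : Rel k
      (fv k (n + 3) * fv k m - (3 : k) • (fv k (n + 2) * fv k (m + 1))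
        + (3 : k) • (fv k (n + 1) * fv k (m + 2)) - fv k n * fv k (m + 3)) 0
  | comm (n m : ℕ) (h : m < n) : Rel k
      (fv k n * fv k m - fv k m * fv k n) (((n : k) - (m : k)) • fv k (n + m - 1))

/-- `Λ = A₊(U(3)) ⊕ k`: the unital associative algebra with generators `v(n)`, `n ≥ 0`, and the
relations `Rel`. No relation has a constant term, so its augmentation ideal is the non-unital
algebra `A₊(U(3))` given by the same generators and relations. -/
abbrev Lam (k : Type u) [Field k] : Type u := RingQuot (Rel k)

/-- The generator `v(n)` of `Λ`. -/
noncomputable def v (k : Type u) [Field k] (n : ℕ) : Lam k :=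
  RingQuot.mkAlgHom k (Rel k) (fv k n)

/-- The augmentation `ε : Λ → k`, `ε(v(n)) = 0`. -/
noncomputable def aug (k : Type u) [Field k] : Lam k →ₐ[k] k :=
  RingQuot.liftAlgHom k ⟨FreeAlgebra.lift k (fun _ => (0 : k)), by
    intro x y h
    cases h <;> simp⟩

/-- The element `v(n₁)⋯v(n_r)` of `Λ` given by the word `[n₁, …, n_r]`. -/
noncomputable def ev (k : Type u) [Field k] (w : List ℕ) : Lam k := (w.map (v k)).prod

/-! ### Normal words -/

/-- The deg-lex order on words in the `v(n)`, with `v(n) > v(m)` iff `n > m`. -/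
abbrev DegLex : List ℕ → List ℕ → Prop := List.Shortlex (fun a b : ℕ => a < b)

/-- A word is normal (reduced) if its image in `Λ` is not a linear combination of deg-lex smaller
words, i.e. it is not the leading word of an element of the ideal of relations. -/
def Normal (k : Type u) [Field k] (w : List ℕ) : Prop :=
  ev k w ∉ Submodule.span k (ev k '' {x | DegLex x w})

theorem ev_append (k : Type u) [Field k] (x y : List ℕ) : ev k (x ++ y) = ev k x * ev k y := by
  simp [ev]

theorem degLex_wf : WellFounded DegLex := List.Shortlex.wf Nat.lt_wfRel.wf

theorem span_ev (k : Type u) [Field k] : Submodule.span k (Set.range (ev k)) = ⊤ := by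
  rw [eq_top_iff]
  rintro x -
  obtain ⟨y, rfl⟩ := RingQuot.mkAlgHom_surjective k (Rel k) x
  induction y using FreeAlgebra.induction with
  | grade0 r =>
    rw [AlgHom.commutes, Algebra.algebraMap_eq_smul_one]
    exact Submodule.smul_mem _ _ (Submodule.subset_span ⟨[], by simp [ev]⟩)
  | grade1 n => exact Submodule.subset_span ⟨[n], by simp [ev, v]⟩
  | mul a b ha hb =>
    rw [map_mul]
    have h := Submodule.mul_mem_mul ha hb
    rw [Submodule.span_mul_span] at h
    refine Submodule.span_mono ?_ h
    rintro _ ⟨_, ⟨p, rfl⟩, _, ⟨q, rfl⟩, rfl⟩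
    exact ⟨p ++ q, ev_append k p q⟩
  | add a b ha hb => rw [map_add]; exact add_mem ha hb

theorem span_normal (k : Type u) [Field k] :
    ⊤ ≤ Submodule.span k (Set.range (fun w : {w : List ℕ // Normal k w} => ev k w.1)) := by
  rw [← span_ev k, Submodule.span_le]
  rintro _ ⟨w, rfl⟩
  induction w using degLex_wf.induction with
  | _ w ih =>
    by_cases h : Normal k w
    · exact Submodule.subset_span ⟨⟨w, h⟩, rfl⟩
    · refine (Submodule.span_le.2 ?_) (not_not.1 h)
      rintro _ ⟨x, hx, rfl⟩
      exact ih x hx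

theorem linearIndependent_normal (k : Type u) [Field k] :
    LinearIndependent k (fun w : {w : List ℕ // Normal k w} => ev k w.1) := by
  classical
  rw [linearIndependent_iff']
  intro s g hs
  by_contra! hne
  obtain ⟨i0, hi0, hg0⟩ := hne
  let r : {w : List ℕ // Normal k w} → {w : List ℕ // Normal k w} → Prop :=
    fun a b => DegLex a.1 b.1
  -- a maximal element of the support
  have hmax : ∃ m ∈ s, g m ≠ 0 ∧ ∀ j ∈ s, g j ≠ 0 → ¬ DegLex m.1 j.1 := by
    have htr : ∀ a b c : List ℕ, DegLex a b → DegLex b c → DegLex a c := by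
      intro a b c hab hbc
      rw [DegLex, List.shortlex_def] at *
      rcases hab with h | ⟨h, h'⟩ <;> rcases hbc with h2 | ⟨h2, h2'⟩
      · left; omega
      · left; omega
      · left; omega
      · exact Or.inr ⟨h.trans h2, (lt_trans (show a < b from h') (show b < c from h2') : a < c)⟩
    by_contra! hcon
    have : ∀ t : Finset {w : List ℕ // Normal k w}, ∃ m ∈ s, g m ≠ 0 ∧
        ∀ j ∈ t, j ∈ s → g j ≠ 0 → DegLex j.1 m.1 ∨ j = m := by
      intro t
      induction t using Finset.induction with
      | empty => exact ⟨i0, hi0, hg0, by simp⟩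
      | insert a t _ ih =>
        obtain ⟨m, hm, hgm, hmt⟩ := ih
        by_cases ha : a ∈ s ∧ g a ≠ 0 ∧ DegLex m.1 a.1
        · refine ⟨a, ha.1, ha.2.1, ?_⟩
          intro j hj hjs hgj
          rcases Finset.mem_insert.1 hj with rfl | hj
          · exact Or.inr rfl
          · rcases hmt j hj hjs hgj with h | rfl
            · exact Or.inl (htr _ _ _ h ha.2.2)
            · exact Or.inl ha.2.2
        · refine ⟨m, hm, hgm, ?_⟩
          intro j hj hjs hgj
          rcases Finset.mem_insert.1 hj with rfl | hj
          · rcases trichotomous_of DegLex j.1 m.1 with h | h | h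
            · exact Or.inl h
            · exact Or.inr (Subtype.ext h)
            · exact absurd ⟨hjs, hgj, h⟩ ha
          · exact hmt j hj hjs hgj
    obtain ⟨m, hm, hgm, hmt⟩ := this s
    obtain ⟨j, hj, hgj, hmj⟩ := hcon m hm hgm
    have hirr : ∀ a : List ℕ, ¬ DegLex a a := fun a h => degLex_wf.irrefl.irrefl a h
    rcases hmt j hj hj hgj with h | rfl
    · exact hirr _ (htr _ _ _ h hmj)
    · exact hirr _ hmj
  obtain ⟨m, hm, hgm, hmj⟩ := hmax
  apply m.2
  have hsplit := Finset.add_sum_erase s (fun i => g i • ev k i.1) hm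
  rw [hs] at hsplit
  have hin : g m • ev k m.1 ∈ Submodule.span k (ev k '' {x | DegLex x m.1}) := by
    rw [eq_neg_of_add_eq_zero_left hsplit]
    refine neg_mem (Submodule.sum_mem _ ?_)
    intro j hj
    obtain ⟨hjm, hjs⟩ := Finset.mem_erase.1 hj
    by_cases hgj : g j = 0
    · simp [hgj]
    · refine Submodule.smul_mem _ _ (Submodule.subset_span ⟨j.1, ?_, rfl⟩)
      rcases trichotomous_of DegLex j.1 m.1 with h | h | h
      · exact h
      · exact absurd (Subtype.ext h) hjm
      · exact absurd h (hmj j hjs hgj)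
  exact (Submodule.smul_mem_iff _ hgm).1 hin

/-- The linear basis of `Λ` that consists of the normal words. -/
noncomputable def normalBasis (k : Type u) [Field k] :
    Module.Basis {w : List ℕ // Normal k w} k (Lam k) :=
  Module.Basis.mk (linearIndependent_normal k) (span_normal k)

/-- The product of two words written in the basis of normal words. -/
noncomputable def nfMul (k : Type u) [Field k] (x y : List ℕ) : List ℕ →₀ k :=
  ((normalBasis k).repr (ev k x * ev k y)).mapDomain Subtype.val

/-! ### The two-sided bar resolution and its graph -/

/-- The enveloping algebra `Λᵉ = Λ ⊗ Λᵒᵖ`. -/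
abbrev Env (k : Type u) [Field k] : Type u := Lam k ⊗[k] (Lam k)ᵐᵒᵖ

/-- The augmentation `ε ⊗ ε : Λᵉ → k`. -/
noncomputable def envAug (k : Type u) [Field k] : Env k →ₐ[k] k :=
  Algebra.TensorProduct.lift (aug k)
    (AlgHom.fromOpposite (aug k) (fun _ _ => Commute.all _ _)) (fun _ _ => Commute.all _ _)

/-- `[w₁|…|w_n]` is a vertex: all `w_i` are non-empty normal words. The non-empty normal words form
a basis of the augmentation ideal of `Λ`, and the vertices with `n` entries form a basis of the
`n`th term `Λ ⊗ (ker ε)^{⊗ n} ⊗ Λ` of the normalized bar resolution as a free `Λᵉ`-module. -/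
def IsVertex (k : Type u) [Field k] (c : List (List ℕ)) : Prop :=
  ∀ w ∈ c, w ≠ [] ∧ Normal k w

/-- The inner part of the bar differential:
`∑_{i=1}^{n-1} (-1)^i [w₁|…|w_i w_{i+1}|…|w_n]`, products being written in normal words. -/
noncomputable def innerD (k : Type u) [Field k] : List (List ℕ) → (List (List ℕ) →₀ k)
  | [] => 0
  | [_] => 0
  | x :: y :: r =>
      -((nfMul k x y).mapDomain (fun z => z :: r))
        - (innerD k (y :: r)).mapDomain (fun c => x :: c)

/-- The differential of the two-sided bar resolution on the basis:
`w₁[w₂|…|w_n] + ∑_{i=1}^{n-1} (-1)^i [w₁|…|w_i w_{i+1}|…|w_n] + (-1)^n [w₁|…|w_{n-1}]w_n`. The value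
at a vertex `c` is the weight of the edge to `c` in the graph of the bar resolution (and there is
such an edge iff the weight is nonzero). -/
noncomputable def barD (k : Type u) [Field k] : List (List ℕ) → (List (List ℕ) →₀ Env k)
  | [] => 0
  | x :: r =>
      Finsupp.single r (ev k x ⊗ₜ[k] 1)
        + (innerD k (x :: r)).mapRange (algebraMap k (Env k)) (map_zero _)
        + Finsupp.single (x :: r).dropLast
            ((-1) ^ (r.length + 1)
              * (1 ⊗ₜ[k] MulOpposite.op (ev k ((x :: r).getLast (List.cons_ne_nil x r)))))

/-! ### Anick chains, the Morse matching, and the Anick complex -/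

/-- `[w₁|…|w_n]` is an Anick `(n-1)`-chain: `w₁` is a letter, and for every `i` the word
`w_i w_{i+1}` is not normal, while `w_i p` is normal for every proper prefix `p` of `w_{i+1}`.
The empty tuple is the unique `(-1)`-chain. -/
structure IsAnickChain (k : Type u) [Field k] (c : List (List ℕ)) : Prop where
  isVertex : IsVertex k c
  head : ∀ w, c.head? = some w → w.length = 1
  chain : c.IsChain (fun x y => ¬ Normal k (x ++ y) ∧
    ∀ p, p <+: y → p ≠ y → Normal k (x ++ p))

/-- The Morse matching on the graph of the bar resolution. If
`c = [w₁|…|w_i|w_{i+1}|…|w_n]` is a vertex, `[w₁|…|w_i]` is its longest initial segment that is an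
Anick chain, and `w_{i+1} = pq` where `p`, `q` are non-empty and `[w₁|…|w_i|p]` is an Anick chain,
then the edge from `b = [w₁|…|w_i|p|q|…|w_n]` to `c` is matched. The vertices that belong to no
matched edge are the Anick chains. -/
def Matched (k : Type u) [Field k] (b c : List (List ℕ)) : Prop :=
  ∃ (a : List (List ℕ)) (p q : List ℕ) (r : List (List ℕ)),
    b = a ++ p :: q :: r ∧ c = a ++ (p ++ q) :: r ∧ IsVertex k b ∧ IsVertex k c ∧
    IsAnickChain k a ∧ ¬ IsAnickChain k (a ++ [p ++ q]) ∧ IsAnickChain k (a ++ [p])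

open Classical in
/-- Weights of the edges of the graph in which every matched edge of weight `w` is reversed and
given the weight `-w⁻¹`; the weight is zero where there is no edge. -/
noncomputable def morseWeight (k : Type u) [Field k] (b c : List (List ℕ)) : Env k :=
  if Matched k c b then -Ring.inverse (barD k c b)
  else if Matched k b c then 0
  else barD k b c

/-- The weight of the path that starts at `b` and then visits the vertices in the given list: the
product of the weights of its edges. A list is a path of that graph iff none of these is zero. -/
noncomputable def pathWeight (k : Type u) [Field k] :
    List (List ℕ) → List (List (List ℕ)) → Env k
  | _, [] => 1
  | b, c :: l => morseWeight k b c * pathWeight k c l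

/-- `l` describes a path from `b` in the graph with the matched edges reversed. -/
def IsPath (k : Type u) [Field k] (b : List (List ℕ)) (l : List (List (List ℕ))) : Prop :=
  (b :: l).IsChain (fun x y => morseWeight k x y ≠ 0)

/-- `Γ(b, a) ∈ Λᵉ`: the sum of the weights of all paths from `b` to `a`. -/
noncomputable def Gam (k : Type u) [Field k] (b a : List (List ℕ)) : Env k :=
  ∑ᶠ l ∈ {l : List (List (List ℕ)) | IsPath k b l ∧ l.getLastD b = a}, pathWeight k b l

/-- The set of Anick chains with `n` entries. -/
def Chain (k : Type u) [Field k] (n : ℕ) : Type :=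
  {c : List (List ℕ) // IsAnickChain k c ∧ c.length = n}

/-- The differential of the Anick resolution `A_•(Λ, Λ)`, whose `n`th term is the free
`Λᵉ`-module on `Chain k n`, on a basis element: `b ↦ ∑ₐ Γ(b, a) a`. -/
noncomputable def anickResD (k : Type u) [Field k] (n : ℕ) (b : Chain k (n + 1)) :
    Chain k n →₀ Env k :=
  ∑ᶠ a : Chain k n, Finsupp.single a (Gam k b.1 a.1)

/-- The `n`th term of `A_• = A_•(Λ, Λ) ⊗_{Λᵉ} k`: the vector space with basis `Chain k n`. -/
abbrev A (k : Type u) [Field k] (n : ℕ) : Type u := Chain k n →₀ k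

/-- The differential `d_{n+1} : A_{n+1} → A_n` of `A_•`: the matrix of the differential of the
Anick resolution with the augmentation applied to its entries. -/
noncomputable def anickD (k : Type u) [Field k] (n : ℕ) : A k (n + 1) →ₗ[k] A k n :=
  Finsupp.linearCombination k
    (fun b => (anickResD k n b).mapRange (envAug k) (map_zero _))

/-! ### Notation for the formula -/

/-- The tuple `[v(i₁)|…|v(i_n)]`. -/
def letters (n : ℕ) (i : ℕ → ℕ) : List (List ℕ) := (List.range n).map (fun s => [i (s + 1)])

open Classical in
/-- The element `[i₁|…|i_n]` of `A_n`, read as zero if it is not an Anick chain. -/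
noncomputable def bracket (k : Type u) [Field k] (n : ℕ) (i : ℕ → ℕ) : A k n :=
  if h : IsAnickChain k (letters n i) then
    Finsupp.single ⟨letters n i, h, by simp [letters]⟩ 1
  else 0

/-- `(i₁, …, i_{j-1}, x, i_{j+2}, …)`: the entries `i_j, i_{j+1}` are replaced by the one entry
`x`. -/
def merge (i : ℕ → ℕ) (j x : ℕ) : ℕ → ℕ :=
  fun s => if s < j then i s else if s = j then x else i (s + 1)

/-- `(i₁, …, i_t - 1, …)`: the entry `i_t` is lowered by one. -/
def lower (i : ℕ → ℕ) (t : ℕ) : ℕ → ℕ := Function.update i t (i t - 1)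

/-- The three sums, with `j ≤ m`, that occur in both cases of the formula, for tuples
`[i₁|…|i_{n+1}]`. -/
noncomputable def mergeSums (k : Type u) [Field k] (n m : ℕ) (i : ℕ → ℕ) : A k n :=
  ∑ j ∈ Finset.Icc 1 m,
      ((-1 : k) ^ j * ((i j : k) * ((i j : k) - 1) / ((i j : k) + (i (j + 1) : k) - 1))) •
        bracket k n (merge i j (i j + i (j + 1) - 1))
    - ∑ j ∈ Finset.Icc 2 m, ∑ t ∈ Finset.Icc 1 (j - 1),
      ((-1 : k) ^ j * ((i t : k) *
          (((i j : k) - 1) * ((i (j + 1) : k) - 1) / ((i j : k) + (i (j + 1) : k) - 1)))) •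
        bracket k n (lower (merge i j (i j + i (j + 1))) t)
    + ∑ j ∈ Finset.Icc 2 m, ∑ t ∈ Finset.Icc 1 (j - 1),
      ((-1 : k) ^ j * ((i j : k) * (i (j + 1) : k) / ((i j : k) + (i (j + 1) : k) - 1) *
          ((i t : k) - 1))) •
        bracket k n (merge i j (i j + i (j + 1) - 1))

end AnickU3

/-!
The relations of `Λ` amount to two rewriting rules: `v(n) v(m)` with `n ≥ 2` is a combination of
`v(0) v(n+m)`, `v(1) v(n+m-1)` and `v(n+m-1)` (`v_mul_v`), because locality makes
`n ↦ v(n) v(s-n)` a quadratic polynomial on `0 ≤ n ≤ s`; and `v(1) v(0) = v(0) v(1) + v(0)`. That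
there are no further rules, so that the normal words are exactly `0ᵃ1ᵇ` and `0ᵃ1ᵇm` with `m ≥ 2`
(`normal_iff`), follows from the action of `Λ` on tensor densities of generic weight `X`, on which
these words act linearly independently. All obstructions have length two, so the Anick chains are
tuples of letters with no normal pair of neighbours (`isAnickChain_iff`).

Paths in the Morse graph are finite in number because every edge lowers the concatenated word in
deg-lex order or keeps it and lowers an auxiliary number (`pathRank`). For a fixed critical `a`, let
`G(c)` be the augmented path sum `ε(Γ(c, a))` (`augGam`). It is zero on tuples with fewer entries
than `a`, since a path can only enter `a` from above. Hence, on tuples with as many entries as `a`,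
`G` is the indicator of `a` at every tuple that is not split, and it vanishes on the inner boundary
of every tuple that arises by a splitting (`augGamLin_innerD_of_matched`), the term at the lower end
of the matched edge cancelling the others; at a critical tuple with one more entry, `G` is the value
on the inner boundary (`augGam_of_isAnickChain`).

These equations are solved by induction on the length `l` of the initial chain, the letters `i_t`
being at least `2`:

* `G[i₁|…|i_l|0 y|R] = ∑_t i_t G[i₁|…|i_t-1|…|i_l|y|R]` (`LowerFormula`),
* `G[i₁|…|i_l|1 y|R] = ∑_t (i_t-1) G[i₁|…|i_l|y|R]` for `y ≥ 2` (`ScaleFormula`).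

After a letter `x ∈ {0, 1}` has been split off, merging `i_l` with `x` moves `x` one step to the
left past `i_l`, plus one shorter term; all other mergings lead to tuples with a normal pair of letters,
which can no longer reach a chain. In the case `x = 1` the mergings behind `x` can produce a new
`0 y`, for which `augGam_one_split` gives the vanishing. Substituting the two formulas in the inner
boundary of a critical tuple, expanded by `v_mul_v`, yields the three sums of the theorem; in
`[i₁|…|i_{n-1}|1|0]` the last two mergings are `v(i_{n-1}) v(1)` and `v(1) v(0)`.
-/

open scoped TensorProduct

namespace AnickU3

universe u

/-! ### Products of two generators -/

section Relations

variable (k : Type u) [Field k]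

theorem v_locality (n m : ℕ) :
    v k (n + 3) * v k m - (3 : k) • (v k (n + 2) * v k (m + 1))
      + (3 : k) • (v k (n + 1) * v k (m + 2)) - v k n * v k (m + 3) = 0 := by
  simpa [v] using RingQuot.mkAlgHom_rel k (Rel.loc (k := k) n m)

theorem v_comm {n m : ℕ} (h : m < n) :
    v k n * v k m - v k m * v k n = ((n : k) - (m : k)) • v k (n + m - 1) := by
  simpa [v] using RingQuot.mkAlgHom_rel k (Rel.comm (k := k) n m h)

theorem v_one_mul_v_zero : v k 1 * v k 0 = v k 0 * v k 1 + v k 0 := by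
  have h := v_comm k (n := 1) (m := 0) one_pos
  simp only [Nat.cast_one, Nat.cast_zero, sub_zero, one_smul] at h
  rw [sub_eq_iff_eq_add'] at h
  exact h

/-- Locality says that `n ↦ v(n) v(s - n)` has vanishing third differences, so that on
`0 ≤ n ≤ s` it is given by Newton's quadratic interpolation. -/
theorem v_mul_v_interpolation [CharZero k] (n m : ℕ) (h : 2 ≤ n + m) :
    v k n * v k m = v k 0 * v k (n + m)
      + (n : k) • (v k 1 * v k (n + m - 1) - v k 0 * v k (n + m))
      + ((n : k) * ((n : k) - 1) / 2) • (v k 2 * v k (n + m - 2)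
          - (2 : k) • (v k 1 * v k (n + m - 1)) + v k 0 * v k (n + m)) := by
  induction n using Nat.strong_induction_on generalizing m with
  | _ n ih =>
    match n with
    | 0 => simp
    | 1 => simp [show 1 + m - 1 = m by omega]
    | 2 =>
      rw [show 2 + m - 2 = m by omega, show 2 + m - 1 = m + 1 by omega, add_comm 2 m]
      push_cast
      match_scalars <;> norm_num
    | n + 3 =>
      have h0 := ih n (by omega) (m + 3) (by omega)
      have h1 := ih (n + 1) (by omega) (m + 2) (by omega)
      have h2 := ih (n + 2) (by omega) (m + 1) (by omega)
      rw [show n + (m + 3) = n + 3 + m by omega] at h0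
      rw [show n + 1 + (m + 2) = n + 3 + m by omega] at h1
      rw [show n + 2 + (m + 1) = n + 3 + m by omega] at h2
      have hl := v_locality k n m
      rw [h0, h1, h2] at hl
      rw [← sub_eq_zero, ← hl]
      push_cast
      match_scalars <;> field_simp <;> ring

/-- The rewriting rule for the obstructions `v(n) v(m)`, `n ≥ 2`: the interpolation formula, with
its quadratic coefficient found from `v(s) v(0) - v(0) v(s) = s v(s - 1)`. -/
theorem v_mul_v [CharZero k] {n : ℕ} (hn : 2 ≤ n) (m : ℕ) :
    v k n * v k m =
      (-(((n : k) - 1) * ((m : k) - 1) / ((n : k) + (m : k) - 1))) • (v k 0 * v k (n + m))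
      + ((n : k) * (m : k) / ((n : k) + (m : k) - 1)) • (v k 1 * v k (n + m - 1))
      + ((n : k) * ((n : k) - 1) / ((n : k) + (m : k) - 1)) • v k (n + m - 1) := by
  have h1 := v_mul_v_interpolation k n m (by omega)
  have h2 := v_mul_v_interpolation k (n + m) 0 (by omega)
  have h3 := v_comm k (n := n + m) (m := 0) (by omega)
  simp only [add_zero] at h2 h3
  rw [sub_eq_iff_eq_add] at h3
  rw [h3] at h2
  obtain ⟨s, hs⟩ : ∃ s, n + m = s + 2 := ⟨n + m - 2, by omega⟩
  have hm : (m : k) = (s : k) + 2 - n := by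
    rw [eq_sub_iff_add_eq]; norm_cast; omega
  have hs1 : (s : k) + 1 ≠ 0 := by exact_mod_cast s.succ_ne_zero
  have hs2 : (s : k) + 2 ≠ 0 := by exact_mod_cast (s + 1).succ_ne_zero
  have hden : (n : k) + m - 1 = s + 1 := by rw [hm]; ring
  rw [hden, h1]
  rw [hs] at h2 ⊢
  simp only [Nat.add_sub_cancel, show s + 2 - 1 = s + 1 by omega] at *
  generalize v k 0 * v k (s + 2) = x0 at *
  generalize v k 1 * v k (s + 1) = x1 at *
  generalize v k 2 * v k s = x2 at *
  generalize v k (s + 1) = y at *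
  have h2' : x2 = (2 / ((s : k) + 1)) • (y - x1 + x0) + (2 : k) • x1 - x0 := by
    push_cast at h2
    have : (((s : k) + 2) * ((s : k) + 1) / 2) •
        (x2 - ((2 / ((s : k) + 1)) • (y - x1 + x0) + (2 : k) • x1 - x0)) = 0 := by
      rw [← sub_eq_zero] at h2
      rw [← neg_eq_zero, ← h2]
      match_scalars <;> field_simp <;> ring
    rw [smul_eq_zero_iff_right (div_ne_zero (mul_ne_zero hs2 hs1) two_ne_zero)] at this
    rwa [sub_eq_zero] at this
  rw [h2', hm]
  match_scalars <;> field_simp <;> ring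

end Relations

/-! ### A representation of `Λ` -/

section Representation

open Polynomial

variable (k : Type u) [Field k]

/-- The operator of the tensor density representation by which `v(n)` acts on `k[X]`-valued
functions on `ℤ`: `(T_n g)(s) = -(s + n X) g(s + 1 - n)`, the density weight `X` being generic. -/
noncomputable def densityOp (n : ℕ) : Module.End k (ℤ → k[X]) where
  toFun g s := -(((s : k[X]) + (n : k[X]) * X) * g (s + 1 - n))
  map_add' f g := by ext1 s; simp only [Pi.add_apply]; ring
  map_smul' c g := by ext1 s; simp

theorem densityOp_apply (n : ℕ) (g : ℤ → k[X]) (s : ℤ) :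
    densityOp k n g s = -(((s : k[X]) + (n : k[X]) * X) * g (s + 1 - n)) := rfl

/-- The action of `Λ` on `k[X]`-valued functions on `ℤ`. -/
noncomputable def densityRep : Lam k →ₐ[k] Module.End k (ℤ → k[X]) :=
  RingQuot.liftAlgHom k ⟨FreeAlgebra.lift k (densityOp k), by
    intro x y h
    cases h with
    | loc n m =>
      ext1 g
      ext1 s
      simp only [map_add, map_sub, map_smul, map_mul, FreeAlgebra.lift_ι_apply, map_zero,
        LinearMap.add_apply, LinearMap.sub_apply, LinearMap.smul_apply, Module.End.mul_apply,
        Pi.add_apply, Pi.sub_apply, Pi.smul_apply, densityOp_apply, LinearMap.zero_apply,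
        Pi.zero_apply]
      have e1 : s + 1 - ((n + 2 : ℕ) : ℤ) + 1 - ((m + 1 : ℕ) : ℤ)
        = s + 1 - ((n + 3 : ℕ) : ℤ) + 1 - (m : ℤ) := by push_cast; ring
      have e2 : s + 1 - ((n + 1 : ℕ) : ℤ) + 1 - ((m + 2 : ℕ) : ℤ)
        = s + 1 - ((n + 3 : ℕ) : ℤ) + 1 - (m : ℤ) := by push_cast; ring
      have e3 : s + 1 - (n : ℤ) + 1 - ((m + 3 : ℕ) : ℤ)
        = s + 1 - ((n + 3 : ℕ) : ℤ) + 1 - (m : ℤ) := by push_cast; ring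
      rw [e1, e2, e3]
      simp only [smul_eq_C_mul, map_ofNat]
      push_cast
      ring
    | comm n m h =>
      ext1 g
      ext1 s
      simp only [map_sub, map_smul, map_mul, FreeAlgebra.lift_ι_apply,
        LinearMap.sub_apply, LinearMap.smul_apply, Module.End.mul_apply,
        Pi.sub_apply, Pi.smul_apply, densityOp_apply]
      have e0 : ((n + m - 1 : ℕ) : ℤ) = n + m - 1 := by omega
      have e0' : ((n + m - 1 : ℕ) : k[X]) = n + m - 1 := by
        have := congrArg (Int.cast : ℤ → k[X]) e0
        push_cast at this
        exact this
      have e1 : s + 1 - (n : ℤ) + 1 - m = s + 1 - ((n + m - 1 : ℕ) : ℤ) := by omega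
      have e2 : s + 1 - (m : ℤ) + 1 - n = s + 1 - ((n + m - 1 : ℕ) : ℤ) := by omega
      rw [e1, e2, e0']
      simp only [smul_eq_C_mul, map_sub, map_natCast]
      push_cast
      ring⟩

theorem densityRep_v (n : ℕ) : densityRep k (v k n) = densityOp k n := by
  simp [densityRep, v]

theorem densityRep_ev_cons (n : ℕ) (w : List ℕ) (g : ℤ → k[X]) (s : ℤ) :
    densityRep k (ev k (n :: w)) g s
      = -(((s : k[X]) + (n : k[X]) * X) * densityRep k (ev k w) g (s + 1 - n)) := by
  rw [ev, List.map_cons, List.prod_cons, map_mul, densityRep_v, Module.End.mul_apply,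
    densityOp_apply]
  rfl

/-- `v(1)^b` acts on the value at `0` as multiplication by `(-X)^b`. -/
theorem densityRep_replicate_one (b : ℕ) (t : List ℕ) (g : ℤ → k[X]) :
    densityRep k (ev k (List.replicate b 1 ++ t)) g 0
      = (-X) ^ b * densityRep k (ev k t) g 0 := by
  induction b with
  | zero => simp
  | succ b ih =>
    rw [List.replicate_succ, List.cons_append, densityRep_ev_cons]
    have : (0 : ℤ) + 1 - (1 : ℕ) = 0 := by norm_num
    rw [this, ih]
    push_cast
    ring

/-- Each factor `v(0)` moves the point of evaluation one step to the right, up to a scalar. -/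
theorem densityRep_replicate_zero_self (a : ℕ) (t : List ℕ) (g : ℤ → k[X]) :
    densityRep k (ev k (List.replicate a 0 ++ t)) g (-(a : ℤ))
      = (a.factorial : k[X]) * densityRep k (ev k t) g 0 := by
  induction a with
  | zero => simp
  | succ a ih =>
    rw [List.replicate_succ, List.cons_append, densityRep_ev_cons]
    have : -((a + 1 : ℕ) : ℤ) + 1 - ((0 : ℕ) : ℤ) = -(a : ℤ) := by push_cast; ring
    rw [this, ih, Nat.factorial_succ]
    push_cast
    ring

/-- The scalar by which a factor `v(0)` acts vanishes at the point `0`, and with more than `c` such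
factors the evaluation at `-c` passes through this point. -/
theorem densityRep_replicate_zero_of_lt {a c : ℕ} (h : c < a) (t : List ℕ) (g : ℤ → k[X]) :
    densityRep k (ev k (List.replicate a 0 ++ t)) g (-(c : ℤ)) = 0 := by
  induction c generalizing a with
  | zero =>
    obtain ⟨a, rfl⟩ : ∃ d, a = d + 1 := ⟨a - 1, by omega⟩
    rw [List.replicate_succ, List.cons_append, densityRep_ev_cons]
    simp
  | succ c ih =>
    obtain ⟨a, rfl⟩ : ∃ d, a = d + 1 := ⟨a - 1, by omega⟩
    rw [List.replicate_succ, List.cons_append, densityRep_ev_cons]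
    have : -((c + 1 : ℕ) : ℤ) + 1 - ((0 : ℕ) : ℤ) = -(c : ℤ) := by push_cast; ring
    rw [this, ih (by omega), mul_zero, neg_zero]

end Representation

/-! ### The normal words -/

/-- The two-letter words `ab` that are normal. -/
def Allowed (a b : ℕ) : Prop := a = 0 ∨ (a = 1 ∧ b ≠ 0)

theorem not_allowed_iff {a b : ℕ} : ¬ Allowed a b ↔ 2 ≤ a ∨ (a = 1 ∧ b = 0) := by
  unfold Allowed; omega

/-- The words without forbidden subwords are `0ᵃ1ᵇ` and `0ᵃ1ᵇm` with `m ≥ 2`. -/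
theorem exists_of_isChain_allowed {w : List ℕ} (h : w.IsChain Allowed) :
    ∃ a b t, w = List.replicate a 0 ++ (List.replicate b 1 ++ t) ∧
      (t = [] ∨ ∃ m, 2 ≤ m ∧ t = [m]) := by
  induction w with
  | nil => exact ⟨0, 0, [], by simp⟩
  | cons x w ih =>
    obtain ⟨a, b, t, rfl, ht⟩ := ih h.tail
    rcases Nat.lt_or_ge x 2 with hx | hx
    · interval_cases x
      · exact ⟨a + 1, b, t, by simp [List.replicate_succ], ht⟩
      · cases a with
        | zero => exact ⟨0, b + 1, t, by simp [List.replicate_succ], ht⟩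
        | succ a =>
          rw [List.replicate_succ, List.cons_append, List.isChain_cons_cons] at h
          exact absurd h.1 (by simp [Allowed])
    · have hnil : List.replicate a 0 ++ (List.replicate b 1 ++ t) = [] := by
        generalize List.replicate a 0 ++ (List.replicate b 1 ++ t) = l at h
        cases l with
        | nil => rfl
        | cons y l => exact absurd (List.isChain_cons_cons.1 h).1 (by unfold Allowed; omega)
      rw [hnil]
      exact ⟨0, 0, [x], by simp, Or.inr ⟨x, hx, rfl⟩⟩

section NormalWords

open Polynomial

variable (k : Type u) [Field k]

theorem degLex_trans {a b c : List ℕ} (hab : DegLex a b) (hbc : DegLex b c) : DegLex a c := by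
  rw [DegLex, List.shortlex_def] at *
  rcases hab with h | ⟨h, h'⟩ <;> rcases hbc with h2 | ⟨h2, h2'⟩
  · left; omega
  · left; omega
  · left; omega
  · exact Or.inr ⟨h.trans h2, (lt_trans (show a < b from h') (show b < c from h2') : a < c)⟩

theorem degLex_irrefl (a : List ℕ) : ¬ DegLex a a := fun h => degLex_wf.irrefl.irrefl a h

theorem degLex_append_append {x y : List ℕ} (h : DegLex x y) (u w : List ℕ) :
    DegLex (u ++ x ++ w) (u ++ y ++ w) := by
  have h := h.append_left u
  rw [DegLex, List.shortlex_def] at *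
  rcases h with h | ⟨h, h'⟩
  · left; simp only [List.length_append] at *; omega
  · refine Or.inr ⟨by simp only [List.length_append] at *; omega, ?_⟩
    generalize u ++ x = p at *
    generalize u ++ y = q at *
    induction h' with
    | nil => simp at h
    | cons _ ih => exact List.Lex.cons (ih (by simpa using h))
    | rel h'' => exact List.Lex.rel h''

/-- A forbidden two-letter word is a combination of smaller words. -/
theorem ev_pair_mem_span [CharZero k] {a b : ℕ} (h : ¬ Allowed a b) :
    ev k [a, b] ∈ Submodule.span k (ev k '' {x | DegLex x [a, b]}) := by
  have hmem : ∀ x, DegLex x [a, b] →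
      ev k x ∈ Submodule.span k (ev k '' {x | DegLex x [a, b]}) :=
    fun x hx => Submodule.subset_span ⟨x, hx, rfl⟩
  have hlt : ∀ c d, c < a → DegLex [c, d] [a, b] := fun c d hc =>
    List.Shortlex.of_lex rfl (List.Lex.rel hc)
  have h1 : ∀ c, DegLex [c] [a, b] := fun c => List.Shortlex.of_length_lt (by simp)
  rcases not_allowed_iff.1 h with ha | ⟨rfl, rfl⟩
  · have e : ev k [a, b] = v k a * v k b := by simp [ev]
    rw [e, v_mul_v k ha b]
    refine add_mem (add_mem (Submodule.smul_mem _ _ ?_) (Submodule.smul_mem _ _ ?_))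
      (Submodule.smul_mem _ _ ?_)
    · simpa [ev] using hmem [0, a + b] (hlt _ _ (by omega))
    · simpa [ev] using hmem [1, a + b - 1] (hlt _ _ (by omega))
    · simpa [ev] using hmem [a + b - 1] (h1 _)
  · have e : ev k [1, 0] = v k 1 * v k 0 := by simp [ev]
    rw [e, v_one_mul_v_zero]
    refine add_mem ?_ ?_
    · simpa [ev] using hmem [0, 1] (hlt _ _ (by omega))
    · simpa [ev] using hmem [0] (h1 _)

theorem isChain_allowed_of_normal [CharZero k] {w : List ℕ} (h : Normal k w) :
    w.IsChain Allowed := by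
  by_contra hw
  rw [List.isChain_iff_forall_rel_of_append_cons_cons] at hw
  push Not at hw
  obtain ⟨a, b, u, r, rfl, hab⟩ := hw
  apply h
  have e : ev k (u ++ a :: b :: r) = ev k u * ev k [a, b] * ev k r := by
    rw [← ev_append, ← ev_append]; simp
  rw [e]
  have hp := ev_pair_mem_span k hab
  let f : Lam k →ₗ[k] Lam k :=
    (LinearMap.mulRight k (ev k r)).comp (LinearMap.mulLeft k (ev k u))
  have hf := Submodule.mem_map_of_mem (f := f) hp
  rw [Submodule.map_span] at hf
  refine Submodule.span_mono ?_ hf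
  rintro _ ⟨_, ⟨x, hx, rfl⟩, rfl⟩
  refine ⟨u ++ x ++ r, ?_, by simp [f, ev_append, mul_assoc]⟩
  have := degLex_append_append hx u r
  simpa using this

/-- The test function for a word with tail `t`: the indicator of the point at which a word with
tail `t`, acting on it, reads it off. -/
noncomputable def testFun (t : List ℕ) : ℤ → k[X] :=
  Pi.single (match t with | [] => 0 | m :: _ => 1 - (m : ℤ)) 1

theorem linearIndependent_allowed [CharZero k] :
    LinearIndependent k (fun w : {w : List ℕ // w.IsChain Allowed} => ev k w.1) := by
  classical
  rw [linearIndependent_iff']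
  intro s g hs
  by_contra! hne
  -- a word of the support with the fewest letters `0`
  obtain ⟨⟨w, hw⟩, hwm, hmin⟩ := Finset.exists_min_image
    (s.filter (fun i => g i ≠ 0)) (fun i => i.1.count 0)
    (by obtain ⟨i, hi, hg⟩ := hne; exact ⟨i, by simp [hi, hg]⟩)
  obtain ⟨hws, hgw⟩ := Finset.mem_filter.1 hwm
  obtain ⟨a, b, t, rfl, ht⟩ := exists_of_isChain_allowed hw
  have ht0 : ∀ {t : List ℕ}, (t = [] ∨ ∃ m, 2 ≤ m ∧ t = [m]) → t.count 0 = 0 := by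
    rintro t (rfl | ⟨m, hm, rfl⟩)
    · simp
    · simp [List.count_singleton]; omega
  have hcount : ∀ {a b : ℕ} {t : List ℕ}, (t = [] ∨ ∃ m, 2 ≤ m ∧ t = [m]) →
      (List.replicate a 0 ++ (List.replicate b 1 ++ t)).count 0 = a := by
    intro a b t ht
    simp [List.count_append, List.count_replicate, ht0 ht]
  -- the coefficient functional that singles out `w` among the words with at least `a` zeros
  let N : ℕ := b + t.length
  let φ : Lam k →ₗ[k] k := (lcoeff k N).comp
    ((LinearMap.proj (-(a : ℤ))).comp
      ((LinearMap.applyₗ (testFun k t)).comp (densityRep k).toLinearMap))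
  have hφ : ∀ x, φ x = (densityRep k x (testFun k t) (-(a : ℤ))).coeff N := fun x => rfl
  have hdiag : φ (ev k (List.replicate a 0 ++ (List.replicate b 1 ++ t))) ≠ 0 := by
    rw [hφ, densityRep_replicate_zero_self, densityRep_replicate_one]
    have hfac : (a.factorial : k) ≠ 0 := by exact_mod_cast a.factorial_ne_zero
    rcases ht with rfl | ⟨m, hm, rfl⟩
    · have : densityRep k (ev k []) (testFun k []) 0 = 1 := by simp [ev, testFun]
      rw [this, mul_one, neg_pow, ← C_eq_natCast, coeff_C_mul,
        show ((-1 : k[X]) ^ b) = C ((-1) ^ b) by simp, coeff_C_mul]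
      simp [N, hfac]
    · have : densityRep k (ev k [m]) (testFun k [m]) 0 = -(C (m : k) * X) := by
        rw [densityRep_ev_cons]; simp [ev, testFun]
      have hm0 : (m : k) ≠ 0 := by exact_mod_cast (by omega : m ≠ 0)
      rw [this, neg_pow, ← C_eq_natCast,
        show (C (a.factorial : k) * ((-1 : k[X]) ^ b * X ^ b * -(C (m : k) * X)))
          = C ((a.factorial : k) * ((-1) ^ b * -(m : k))) * X ^ (b + 1) by
            simp only [map_mul, map_neg, map_pow, map_one]; ring, coeff_C_mul]
      simp [N, hfac, hm0]
  have hoff : ∀ i ∈ s, i ≠ ⟨_, hw⟩ → g i * φ (ev k i.1) = 0 := by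
    rintro ⟨x, hx⟩ hi hxne
    by_cases hgx : g ⟨x, hx⟩ = 0
    · simp [hgx]
    have hle := hmin ⟨x, hx⟩ (Finset.mem_filter.2 ⟨hi, hgx⟩)
    obtain ⟨a', b', t', rfl, ht'⟩ := exists_of_isChain_allowed hx
    simp only [hcount ht, hcount ht'] at hle
    refine mul_eq_zero_of_right _ ?_
    rw [hφ]
    rcases Nat.lt_or_ge a a' with h | h
    · rw [densityRep_replicate_zero_of_lt k h, coeff_zero]
    obtain rfl : a = a' := by omega
    rw [densityRep_replicate_zero_self, densityRep_replicate_one, ← C_eq_natCast, coeff_C_mul]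
    refine mul_eq_zero_of_right _ ?_
    by_cases htt : t' = t
    · subst htt
      have hbb : b' ≠ b := by
        rintro rfl
        exact hxne rfl
      have key : ∀ c : k, ((-X : k[X]) ^ b' * (C c * X ^ t'.length)).coeff N = 0 := by
        intro c
        rw [neg_pow, show (-1 : k[X]) ^ b' * X ^ b' * (C c * X ^ t'.length)
          = C ((-1) ^ b' * c) * X ^ (b' + t'.length) by
            simp only [map_mul, map_neg, map_pow, map_one]; ring, coeff_C_mul, coeff_X_pow,
          if_neg (by simp only [N]; omega), mul_zero]
      rcases ht' with rfl | ⟨m, hm, rfl⟩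
      · have : densityRep k (ev k []) (testFun k []) 0 = C 1 * X ^ 0 := by simp [ev, testFun]
        rw [this]
        exact key 1
      · have : densityRep k (ev k [m]) (testFun k [m]) 0 = C (-(m : k)) * X ^ 1 := by
          rw [densityRep_ev_cons]; simp [ev, testFun]
        rw [this]
        exact key _
    · have : densityRep k (ev k t') (testFun k t) 0 = 0 := by
        rcases ht with rfl | ⟨m, hm, rfl⟩ <;> rcases ht' with rfl | ⟨m', hm', rfl⟩
        · exact absurd rfl htt
        · rw [densityRep_ev_cons]
          have : (1 : ℤ) - m' ≠ 0 := by omega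
          simp [ev, testFun, this]
        · have : (0 : ℤ) ≠ 1 - m := by omega
          simp [ev, testFun, this]
        · rw [densityRep_ev_cons]
          have : m' ≠ m := by rintro rfl; exact htt rfl
          simp [ev, testFun, this]
      rw [this, mul_zero, coeff_zero]
  have h0 := congrArg φ hs
  rw [map_sum, map_zero, Finset.sum_eq_single_of_mem _ hws] at h0
  · rw [map_smul, smul_eq_mul] at h0
    exact (mul_ne_zero hgw hdiag) h0
  · intro i hi hne'
    rw [map_smul, smul_eq_mul]
    exact hoff i hi hne'

/-- Every word is a combination of words without forbidden subwords that do not exceed it. -/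
theorem ev_mem_span_allowed [CharZero k] (w : List ℕ) :
    ev k w ∈ Submodule.span k (ev k '' {x | x.IsChain Allowed ∧ (x = w ∨ DegLex x w)}) := by
  induction w using degLex_wf.induction with
  | _ w ih =>
    by_cases h : w.IsChain Allowed
    · exact Submodule.subset_span ⟨w, ⟨h, Or.inl rfl⟩, rfl⟩
    · have hn : ¬ Normal k w := fun hn => h (isChain_allowed_of_normal k hn)
      refine (Submodule.span_le.2 ?_) (not_not.1 hn)
      rintro _ ⟨x, hx, rfl⟩
      refine Submodule.span_mono (Set.image_mono ?_) (ih x hx)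
      rintro y ⟨hy, rfl | hyx⟩
      · exact ⟨hy, Or.inr hx⟩
      · exact ⟨hy, Or.inr (degLex_trans hyx hx)⟩

/-- The normal words are the words without forbidden subwords: the two rewriting rules form a
Gröbner–Shirshov basis. -/
theorem normal_iff [CharZero k] {w : List ℕ} : Normal k w ↔ w.IsChain Allowed := by
  refine ⟨isChain_allowed_of_normal k, fun h hmem => ?_⟩
  have hmem' : ev k w ∈ Submodule.span k
      (ev k '' {x | x.IsChain Allowed ∧ DegLex x w}) := by
    refine (Submodule.span_le.2 ?_) hmem
    rintro _ ⟨x, hx, rfl⟩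
    refine Submodule.span_mono (Set.image_mono ?_) (ev_mem_span_allowed k x)
    rintro y ⟨hy, rfl | hyx⟩
    · exact ⟨hy, hx⟩
    · exact ⟨hy, degLex_trans hyx hx⟩
  refine (linearIndependent_allowed k).notMem_span_image
    (s := {x | DegLex x.1 w}) (x := ⟨w, h⟩) (degLex_irrefl w) ?_
  refine Submodule.span_mono ?_ hmem'
  rintro _ ⟨x, ⟨hx, hxw⟩, rfl⟩
  exact ⟨⟨x, hx⟩, hxw, rfl⟩

end NormalWords

/-! ### Products of normal words -/

section Products

variable (k : Type u) [Field k]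

/-- The expansion of an element of `Λ` in normal words. -/
noncomputable def normalForm : Lam k →ₗ[k] (List ℕ →₀ k) :=
  (Finsupp.lmapDomain k k Subtype.val).comp (normalBasis k).repr.toLinearMap

theorem nfMul_eq_normalForm (x y : List ℕ) : nfMul k x y = normalForm k (ev k (x ++ y)) := by
  rw [ev_append]; rfl

variable {k}

theorem normalForm_ev {w : List ℕ} (h : Normal k w) :
    normalForm k (ev k w) = Finsupp.single w 1 := by
  have : ev k w = normalBasis k ⟨w, h⟩ := by simp [normalBasis]
  rw [normalForm, LinearMap.comp_apply, this]
  simp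

theorem nfMul_of_normal {x y : List ℕ} (h : Normal k (x ++ y)) :
    nfMul k x y = Finsupp.single (x ++ y) 1 := by
  rw [nfMul_eq_normalForm, normalForm_ev h]

theorem aug_ev_of_ne_nil {w : List ℕ} (h : w ≠ []) : aug k (ev k w) = 0 := by
  cases w with
  | nil => exact absurd rfl h
  | cons n w =>
    have : aug k (v k n) = 0 := by simp [aug, v]
    rw [ev, List.map_cons, List.prod_cons, map_mul, this, zero_mul]

/-- The augmentation is the coefficient at the empty word. -/
theorem normalForm_apply_nil (x : Lam k) : normalForm k x [] = aug k x := by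
  have : (Finsupp.lapply []).comp (normalForm k) = (aug k).toLinearMap := by
    refine (normalBasis k).ext fun ⟨w, hw⟩ => ?_
    have e : normalBasis k ⟨w, hw⟩ = ev k w := by simp [normalBasis]
    rw [e, LinearMap.comp_apply, normalForm_ev hw, AlgHom.toLinearMap_apply]
    by_cases h : w = []
    · subst h; simp [ev]
    · rw [aug_ev_of_ne_nil h]; simp [h]
  exact LinearMap.congr_fun this x

theorem ne_nil_of_nfMul {x y z : List ℕ} (hx : x ≠ []) (h : nfMul k x y z ≠ 0) : z ≠ [] := by
  rintro rfl
  rw [nfMul_eq_normalForm, normalForm_apply_nil, aug_ev_of_ne_nil (by simp [hx])] at h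
  exact h rfl

variable [CharZero k]

theorem normal_of_length_le_one {w : List ℕ} (h : w.length ≤ 1) : Normal k w := by
  rw [normal_iff]
  match w with
  | [] => simp
  | [_] => simp
  | _ :: _ :: _ => simp at h

theorem normal_of_append_left {x y : List ℕ} (h : Normal k (x ++ y)) : Normal k x := by
  rw [normal_iff] at *; exact h.left_of_append

/-- The product of words expands in normal words that do not exceed the concatenation. -/
theorem nfMul_support {x y z : List ℕ} (h : nfMul k x y z ≠ 0) :
    Normal k z ∧ (z = x ++ y ∨ DegLex z (x ++ y)) := by
  rw [nfMul_eq_normalForm] at h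
  have hmem : normalForm k (ev k (x ++ y)) ∈
      Finsupp.supported k k {z | Normal k z ∧ (z = x ++ y ∨ DegLex z (x ++ y))} := by
    have := Submodule.mem_map_of_mem (f := normalForm k) (ev_mem_span_allowed k (x ++ y))
    rw [Submodule.map_span] at this
    refine (Submodule.span_le.2 ?_) this
    rintro _ ⟨_, ⟨w, ⟨hw, hle⟩, rfl⟩, rfl⟩
    rw [normalForm_ev ((normal_iff k).2 hw)]
    exact Finsupp.single_mem_supported k 1 ⟨(normal_iff k).2 hw, hle⟩
  exact (Finsupp.mem_supported k _).1 hmem (Finsupp.mem_support_iff.2 h)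

theorem nfMul_letters {n : ℕ} (hn : 2 ≤ n) (m : ℕ) :
    nfMul k [n] [m] =
      (-(((n : k) - 1) * ((m : k) - 1) / ((n : k) + (m : k) - 1))) • Finsupp.single [0, n + m] 1
      + ((n : k) * (m : k) / ((n : k) + (m : k) - 1)) • Finsupp.single [1, n + m - 1] 1
      + ((n : k) * ((n : k) - 1) / ((n : k) + (m : k) - 1)) • Finsupp.single [n + m - 1] 1 := by
  have e : ∀ a b, v k a * v k b = ev k [a, b] := by simp [ev]
  have e1 : ∀ a, v k a = ev k [a] := by simp [ev]
  rw [nfMul_eq_normalForm, List.singleton_append, ← e, v_mul_v k hn, e, e, e1, map_add, map_add,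
    map_smul, map_smul, map_smul, normalForm_ev, normalForm_ev, normalForm_ev]
  · exact normal_of_length_le_one (by simp)
  · rw [normal_iff, List.isChain_pair, Allowed]; omega
  · rw [normal_iff, List.isChain_pair, Allowed]; omega

theorem nfMul_one_zero :
    nfMul k [1] [0] = Finsupp.single [0, 1] 1 + Finsupp.single [0] 1 := by
  have e : ∀ a b, v k a * v k b = ev k [a, b] := by simp [ev]
  have e1 : ∀ a, v k a = ev k [a] := by simp [ev]
  rw [nfMul_eq_normalForm, List.singleton_append, ← e, v_one_mul_v_zero, e, e1, map_add,
    normalForm_ev, normalForm_ev]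
  · exact normal_of_length_le_one (by simp)
  · rw [normal_iff, List.isChain_pair, Allowed]; omega

end Products

/-! ### Anick chains -/

section Chains

variable {k : Type u} [Field k]

theorem IsVertex.append {b c : List (List ℕ)} :
    IsVertex k (b ++ c) ↔ IsVertex k b ∧ IsVertex k c := by
  simp only [IsVertex, List.mem_append, or_imp, forall_and]
  tauto

theorem IsVertex.cons {w : List ℕ} {c : List (List ℕ)} :
    IsVertex k (w :: c) ↔ (w ≠ [] ∧ Normal k w) ∧ IsVertex k c := by
  simp [IsVertex]

theorem IsAnickChain.of_append {b c : List (List ℕ)} (h : IsAnickChain k (b ++ c)) :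
    IsAnickChain k b where
  isVertex := (IsVertex.append.1 h.isVertex).1
  head w hw := h.head w (by rw [List.head?_append, hw]; rfl)
  chain := h.chain.left_of_append

/-- Adjacent entries of an Anick chain have a product that is not normal. -/
theorem IsAnickChain.not_normal {u r : List (List ℕ)} {x y : List ℕ}
    (h : IsAnickChain k (u ++ x :: y :: r)) : ¬ Normal k (x ++ y) :=
  (List.isChain_append_cons_cons.1 h.chain).2.1.1

theorem isAnickChain_nil : IsAnickChain k [] where
  isVertex := by simp [IsVertex]
  head := by simp
  chain := by simp

variable [CharZero k]

/-- The obstructions are quadratic, so the entries of an Anick chain are letters and a tuple of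
letters is an Anick chain iff no two neighbours form a normal word. -/
theorem isAnickChain_iff {c : List (List ℕ)} :
    IsAnickChain k c ↔
      ∃ js : List ℕ, c = js.map (fun j => [j]) ∧ js.IsChain (fun a b => ¬ Allowed a b) := by
  constructor
  · intro h
    have key : ∀ (c : List (List ℕ)) (j : ℕ), IsVertex k c →
        ([j] :: c).IsChain (fun x y => ¬ Normal k (x ++ y) ∧
          ∀ p, p <+: y → p ≠ y → Normal k (x ++ p)) →
        ∃ js : List ℕ, c = js.map (fun j => [j]) ∧
          (j :: js).IsChain (fun a b => ¬ Allowed a b) := by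
      intro c
      induction c with
      | nil => exact fun j _ _ => ⟨[], by simp⟩
      | cons y c ih =>
        intro j hv hc
        obtain ⟨⟨hn, hp⟩, hc⟩ := List.isChain_cons_cons.1 hc
        obtain ⟨⟨hy0, hyn⟩, hvc⟩ := IsVertex.cons.1 hv
        obtain ⟨m, y, rfl⟩ := List.exists_cons_of_ne_nil hy0
        have hjm : ¬ Allowed j m := by
          intro hjm
          refine hn ((normal_iff k).2 ?_)
          rw [List.singleton_append, List.isChain_cons_cons]
          exact ⟨hjm, (normal_iff k).1 hyn⟩
        have hy : y = [] := by
          by_contra hy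
          have := hp [m] ⟨y, rfl⟩ (fun h => hy (List.cons_eq_cons.1 h).2.symm)
          rw [normal_iff, List.singleton_append, List.isChain_pair] at this
          exact hjm this
        subst hy
        obtain ⟨js, rfl, hjs⟩ := ih m hvc hc
        exact ⟨m :: js, rfl, List.isChain_cons_cons.2 ⟨hjm, hjs⟩⟩
    cases c with
    | nil => exact ⟨[], by simp⟩
    | cons x c =>
      obtain ⟨j, rfl⟩ := List.length_eq_one_iff.1 (h.head x rfl)
      obtain ⟨js, rfl, hjs⟩ := key c j (IsVertex.cons.1 h.isVertex).2 h.chain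
      exact ⟨j :: js, rfl, hjs⟩
  · rintro ⟨js, rfl, hjs⟩
    refine ⟨?_, ?_, ?_⟩
    · intro w hw
      obtain ⟨j, -, rfl⟩ := List.mem_map.1 hw
      exact ⟨by simp, normal_of_length_le_one (by simp)⟩
    · intro w hw
      obtain ⟨j, -, rfl⟩ := List.mem_map.1 (List.mem_of_mem_head? hw)
      rfl
    · rw [List.isChain_map]
      refine hjs.imp fun a b hab => ⟨?_, ?_⟩
      · rw [normal_iff, List.singleton_append, List.isChain_pair]
        exact hab
      · intro p hp hne
        have : p = [] := by
          have h1 := hp.length_le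
          by_contra h0
          have h2 := List.length_pos_iff.2 h0
          exact hne (hp.eq_of_length (by simp at h1 ⊢; omega))
        subst this
        exact normal_of_length_le_one (by simp)

theorem IsAnickChain.length_eq_one {c : List (List ℕ)} (h : IsAnickChain k c) {w : List ℕ}
    (hw : w ∈ c) : w.length = 1 := by
  obtain ⟨js, rfl, -⟩ := isAnickChain_iff.1 h
  obtain ⟨j, -, rfl⟩ := List.mem_map.1 hw
  rfl

theorem not_isAnickChain_of_two_le {u : List (List ℕ)} {p q : List ℕ} (hp : p ≠ []) (hq : q ≠ []) :
    ¬ IsAnickChain k (u ++ [p ++ q]) := by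
  intro h
  have h1 := h.length_eq_one (w := p ++ q) (by simp)
  have h2 := List.length_pos_iff.2 hp
  have h3 := List.length_pos_iff.2 hq
  rw [List.length_append] at h1
  omega

end Chains

/-! ### Edges of the graph -/

section Edges

variable {k : Type u} [Field k]

theorem exists_of_innerD_ne_zero {b c : List (List ℕ)} (h : innerD k b c ≠ 0) :
    ∃ u x y r z, b = u ++ x :: y :: r ∧ c = u ++ z :: r ∧ nfMul k x y z ≠ 0 := by
  induction b generalizing c with
  | nil => simp [innerD] at h
  | cons x b ih =>
    cases b with
    | nil => simp [innerD] at h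
    | cons y r =>
      rw [innerD, Finsupp.sub_apply, Finsupp.neg_apply] at h
      by_cases h1 : (nfMul k x y).mapDomain (fun z => z :: r) c = 0
      · rw [h1, neg_zero, zero_sub, neg_ne_zero] at h
        obtain ⟨c', rfl⟩ : c ∈ Set.range (fun c : List (List ℕ) => x :: c) := by
          by_contra hc
          exact h (Finsupp.mapDomain_of_notMem_range _ _ hc)
        rw [Finsupp.mapDomain_apply (fun a b hab => by simpa using hab)] at h
        obtain ⟨u, x', y', r', z, hb, rfl, hz⟩ := ih h
        exact ⟨x :: u, x', y', r', z, by simp [hb], rfl, hz⟩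
      · obtain ⟨z, rfl⟩ : c ∈ Set.range (fun z : List ℕ => z :: r) := by
          by_contra hc
          exact h1 (Finsupp.mapDomain_of_notMem_range _ _ hc)
        rw [Finsupp.mapDomain_apply (fun a b hab => by simpa using hab)] at h1
        exact ⟨[], x, y, r, z, rfl, rfl, h1⟩

theorem exists_of_barD_ne_zero {b c : List (List ℕ)} (h : barD k b c ≠ 0) :
    (∃ x, b = x :: c) ∨ (∃ x, b = c ++ [x]) ∨ innerD k b c ≠ 0 := by
  classical
  cases b with
  | nil => simp [barD] at h
  | cons x r =>
    by_contra! hcon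
    obtain ⟨h1, h2, h3⟩ := hcon
    apply h
    have hr : r ≠ c := fun hrc => h1 x (by rw [hrc])
    have hd : (x :: r).dropLast ≠ c := fun hdc =>
      h2 _ (by rw [← hdc, List.dropLast_append_getLast (List.cons_ne_nil x r)])
    rw [barD, Finsupp.add_apply, Finsupp.add_apply, Finsupp.single_eq_of_ne (Ne.symm hr),
      Finsupp.mapRange_apply, h3, Finsupp.single_eq_of_ne (Ne.symm hd)]
    simp

theorem innerD_matched {p q : List ℕ} (hp : p ≠ []) (hq : q ≠ []) (hpq : Normal k (p ++ q))
    (u r : List (List ℕ)) :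
    innerD k (u ++ p :: q :: r) (u ++ (p ++ q) :: r) = (-1) ^ (u.length + 1) := by
  induction u with
  | nil =>
    have h : (innerD k (q :: r)).mapDomain (fun c => p :: c) ((p ++ q) :: r) = 0 := by
      refine Finsupp.mapDomain_of_notMem_range _ _ ?_
      rintro ⟨c, hc⟩
      simp [hq] at hc
    simp [innerD, h, nfMul_of_normal hpq, Finsupp.mapDomain_single]
  | cons x u ih =>
    obtain ⟨y, s, hys⟩ : ∃ y s, u ++ p :: q :: r = y :: s :=
      List.exists_cons_of_ne_nil (by simp)
    have hs : s ≠ u ++ (p ++ q) :: r := by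
      intro hs
      have h1 := congrArg (fun l => l[u.length + 1]?) hys
      simp [hs, hp] at h1
    have h0 : (nfMul k x y).mapDomain (fun z => z :: s) (x :: (u ++ (p ++ q) :: r)) = 0 := by
      refine Finsupp.mapDomain_of_notMem_range _ _ ?_
      rintro ⟨c, hc⟩
      exact hs (List.cons_eq_cons.1 hc).2
    rw [List.cons_append, List.cons_append, hys, innerD, Finsupp.sub_apply, Finsupp.neg_apply, h0,
      Finsupp.mapDomain_apply (fun a b hab => by simpa using hab), ← hys, ih]
    rw [List.length_cons, pow_succ _ (u.length + 1)]
    ring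

/-- A matched edge arises only from the concatenation of the two words that it splits, so its
weight is a sign. -/
theorem barD_matched {p q : List ℕ} (hp : p ≠ []) (hq : q ≠ []) (hpq : Normal k (p ++ q))
    (u r : List (List ℕ)) :
    barD k (u ++ p :: q :: r) (u ++ (p ++ q) :: r) = (-1) ^ (u.length + 1) := by
  classical
  obtain ⟨y, s, hys⟩ : ∃ y s, u ++ p :: q :: r = y :: s :=
    List.exists_cons_of_ne_nil (by simp)
  have hs : s ≠ u ++ (p ++ q) :: r := by
    intro hs
    have h1 := congrArg (fun l => l[u.length + 1]?) hys
    simp [hs, hp] at h1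
  have hd : (y :: s).dropLast ≠ u ++ (p ++ q) :: r := by
    intro hd
    rw [← hys, List.dropLast_append_of_ne_nil (by simp), List.dropLast_cons_of_ne_nil (by simp)]
      at hd
    simp [hq] at hd
  rw [hys, barD, Finsupp.add_apply, Finsupp.add_apply, Finsupp.single_eq_of_ne (Ne.symm hs),
    Finsupp.single_eq_of_ne (Ne.symm hd), Finsupp.mapRange_apply, ← hys,
    innerD_matched hp hq hpq, map_pow, map_neg, map_one]
  simp

variable [CharZero k]

theorem IsVertex.of_innerD {b c : List (List ℕ)} (hb : IsVertex k b) (h : innerD k b c ≠ 0) :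
    IsVertex k c ∧ b.length = c.length + 1 := by
  obtain ⟨u, x, y, r, z, rfl, rfl, hz⟩ := exists_of_innerD_ne_zero h
  obtain ⟨hu, hxyr⟩ := IsVertex.append.1 hb
  obtain ⟨hx, hyr⟩ := IsVertex.cons.1 hxyr
  obtain ⟨-, hr⟩ := IsVertex.cons.1 hyr
  exact ⟨IsVertex.append.2 ⟨hu, IsVertex.cons.2
    ⟨⟨ne_nil_of_nfMul hx.1 hz, (nfMul_support hz).1⟩, hr⟩⟩, by simp; omega⟩

theorem IsVertex.of_barD {b c : List (List ℕ)} (hb : IsVertex k b) (h : barD k b c ≠ 0) :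
    IsVertex k c ∧ b.length = c.length + 1 := by
  rcases exists_of_barD_ne_zero h with ⟨x, rfl⟩ | ⟨x, rfl⟩ | h
  · exact ⟨(IsVertex.cons.1 hb).2, by simp⟩
  · exact ⟨(IsVertex.append.1 hb).1, by simp⟩
  · exact hb.of_innerD h

end Edges

/-! ### The matching -/

section Matching

variable {k : Type u} [Field k]

/-- A vertex is obtained by at most one splitting. -/
theorem Matched.unique_right {b c c' : List (List ℕ)} (h : Matched k b c) (h' : Matched k b c') :
    c = c' := by
  have key : ∀ {α α' s s' : List (List ℕ)} {p q p' : List ℕ},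
      α ++ p :: q :: s = α' ++ p' :: s' → Normal k (p ++ q) →
      IsAnickChain k (α' ++ [p']) → ∀ as, α' = α ++ as → as = [] := by
    rintro α α' s s' p q p' he hn ha as rfl
    cases as with
    | nil => rfl
    | cons x as =>
      simp only [List.append_assoc, List.cons_append, List.append_cancel_left_eq,
        List.cons.injEq] at he
      obtain ⟨rfl, he⟩ := he
      refine absurd hn ?_
      cases as with
      | nil =>
        obtain ⟨rfl, -⟩ := List.cons_eq_cons.1 he
        exact IsAnickChain.not_normal (u := α) (r := []) (by simpa using ha)
      | cons y as =>
        obtain ⟨rfl, -⟩ := List.cons_eq_cons.1 he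
        exact IsAnickChain.not_normal (u := α) (r := as ++ [p']) (by simpa using ha)
  obtain ⟨α, p, q, r, hb, rfl, -, hv, hα, hn, hp⟩ := h
  obtain ⟨α', p', q', r', hb', rfl, -, hv', hα', hn', hp'⟩ := h'
  have hpq : Normal k (p ++ q) := (hv _ (by simp)).2
  have hpq' : Normal k (p' ++ q') := (hv' _ (by simp)).2
  have he := hb.symm.trans hb'
  obtain rfl : α = α' := by
    rcases List.append_eq_append_iff.1 he with ⟨as, h1, -⟩ | ⟨as, h1, -⟩
    · rw [h1, key he hpq hp' as h1, List.append_nil]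
    · rw [h1, key he.symm hpq' hp as h1, List.append_nil]
  simp only [List.append_cancel_left_eq, List.cons.injEq] at he
  obtain ⟨rfl, rfl, rfl⟩ := he
  rfl

theorem IsAnickChain.not_matched_left {a c : List (List ℕ)} (ha : IsAnickChain k a) :
    ¬ Matched k a c := by
  rintro ⟨α, p, q, r, rfl, rfl, -, hv, -⟩
  exact ha.not_normal (hv _ (by simp)).2

theorem IsAnickChain.not_matched_right {a b : List (List ℕ)} (ha : IsAnickChain k a) :
    ¬ Matched k b a := by
  rintro ⟨α, p, q, r, rfl, rfl, -, -, -, hn, -⟩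
  exact hn (IsAnickChain.of_append (c := r) (by simpa using ha))

theorem Matched.length {b c : List (List ℕ)} (h : Matched k b c) : b.length = c.length + 1 := by
  obtain ⟨α, p, q, r, rfl, rfl, -⟩ := h
  simp; omega

variable [CharZero k]

/-- A vertex is split in at most one way. -/
theorem Matched.unique_left {b b' c : List (List ℕ)} (h : Matched k b c) (h' : Matched k b' c) :
    b = b' := by
  have key : ∀ {α α' s s' : List (List ℕ)} {w w' : List ℕ}, α ++ w :: s = α' ++ w' :: s' →
      ¬ IsAnickChain k (α ++ [w]) → IsAnickChain k α' → ∀ as, α' = α ++ as → as = [] := by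
    rintro α α' s s' w w' he hn ha as rfl
    cases as with
    | nil => rfl
    | cons x as =>
      simp only [List.append_assoc, List.cons_append, List.append_cancel_left_eq,
        List.cons.injEq] at he
      obtain ⟨rfl, -⟩ := he
      exact absurd (IsAnickChain.of_append (c := as) (by simpa using ha)) hn
  obtain ⟨α, p, q, r, rfl, hc, -, -, hα, hn, hp⟩ := h
  obtain ⟨α', p', q', r', rfl, hc', -, -, hα', hn', hp'⟩ := h'
  have he := hc.symm.trans hc'
  obtain rfl : α = α' := by
    rcases List.append_eq_append_iff.1 he with ⟨as, h1, -⟩ | ⟨as, h1, -⟩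
    · rw [h1, key he hn hα' as h1, List.append_nil]
    · rw [h1, key he.symm hn' hα as h1, List.append_nil]
  simp only [List.append_cancel_left_eq, List.cons.injEq] at he
  have h1 := hp.length_eq_one (w := p) (by simp)
  have h2 := hp'.length_eq_one (w := p') (by simp)
  obtain ⟨rfl, rfl⟩ := List.append_inj he.1 (h1.trans h2.symm)
  rw [he.2]

/-- A vertex obtained by a splitting is not split itself. -/
theorem Matched.not_matched_left {b b' c : List (List ℕ)} (h : Matched k b c) :
    ¬ Matched k b' b := by
  intro h'
  obtain ⟨α, p, q, r, hb, rfl, hbv, hv, hα, hn, hp⟩ := h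
  obtain ⟨α', p', q', r', rfl, hb', hbv', hv', hα', hn', hp'⟩ := h'
  have hpq : Normal k (p ++ q) := (hv _ (by simp)).2
  have hp'0 := (hbv' p' (by simp)).1
  have hq'0 := (hbv' q' (by simp)).1
  have hlen : (p' ++ q').length ≠ 1 := by
    have h1 := List.length_pos_iff.2 hp'0
    have h2 := List.length_pos_iff.2 hq'0
    rw [List.length_append]; omega
  have he := hb.symm.trans hb'
  rcases List.append_eq_append_iff.1 he with ⟨as, rfl, h2⟩ | ⟨as, rfl, h2⟩
  · match as with
    | [] =>
      obtain ⟨h3, -⟩ := List.cons_eq_cons.1 h2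
      exact hlen (h3 ▸ hp.length_eq_one (w := p) (by simp))
    | [x] =>
      simp only [List.cons_append, List.nil_append, List.cons.injEq] at h2
      obtain ⟨rfl, rfl, -⟩ := h2
      rw [← List.append_assoc] at hpq
      exact IsAnickChain.not_normal (u := α) (r := []) (by simpa using hp')
        (normal_of_append_left hpq)
    | x :: y :: as =>
      simp only [List.cons_append, List.cons.injEq] at h2
      obtain ⟨rfl, rfl, -⟩ := h2
      exact IsAnickChain.not_normal (u := α) (r := as) hα' hpq
  · cases as with
    | nil =>
      obtain ⟨h3, -⟩ := List.cons_eq_cons.1 h2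
      exact hlen (h3 ▸ hp.length_eq_one (w := p) (by simp))
    | cons x as =>
      simp only [List.cons_append, List.cons.injEq] at h2
      obtain ⟨rfl, -⟩ := h2
      exact hlen (hα.length_eq_one (by simp))

end Matching

/-! ### Finiteness of the sets of paths -/

section Finiteness

variable {k : Type u} [Field k]

variable (k) in
open Classical in
/-- The number of entries of the longest initial segment that is an Anick chain. -/
noncomputable def prefixLength (c : List (List ℕ)) : ℕ :=
  Nat.findGreatest (fun m => IsAnickChain k (c.take m)) c.length

theorem isAnickChain_take_prefixLength (c : List (List ℕ)) :
    IsAnickChain k (c.take (prefixLength k c)) := by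
  classical
  exact Nat.findGreatest_spec (P := fun m => IsAnickChain k (c.take m)) (Nat.zero_le _)
    (by simpa using isAnickChain_nil)

theorem le_prefixLength {α r : List (List ℕ)} (h : IsAnickChain k α) :
    α.length ≤ prefixLength k (α ++ r) := by
  classical
  exact Nat.le_findGreatest (by simp) (by simpa using h)

theorem prefixLength_le_length (c : List (List ℕ)) : prefixLength k c ≤ c.length := by
  classical
  exact Nat.findGreatest_le _

theorem length_le_length_flatten {c : List (List ℕ)} (h : IsVertex k c) :
    c.length ≤ c.flatten.length := by
  induction c with
  | nil => simp
  | cons x c ih =>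
    obtain ⟨⟨hx, -⟩, hc⟩ := IsVertex.cons.1 h
    have := List.length_pos_iff.2 hx
    have := ih hc
    simp only [List.length_cons, List.flatten_cons, List.length_append]
    omega

variable (k) in
/-- The quantity that decreases lexicographically along the edges: the concatenated word, and for
equal words a combination of the length behind the initial Anick chain and the number of entries.
A splitting extends the initial Anick chain, which outweighs the additional entry because of the
factor `2`. A merging that keeps the word and is not a matched edge lowers the number of entries and
does not shorten the initial Anick chain. -/
noncomputable def pathRank (c : List (List ℕ)) : List ℕ × ℕ :=
  (c.flatten, 2 * (c.flatten.length - prefixLength k c) + c.length)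

variable (k) in
/-- The well-founded relation on tuples given by `pathRank`. -/
def RankLT (c b : List (List ℕ)) : Prop :=
  Prod.Lex DegLex (· < ·) (pathRank k c) (pathRank k b)

variable (k) in
theorem rankLT_wf : WellFounded (RankLT k) :=
  InvImage.wf (pathRank k) (degLex_wf.prod_lex Nat.lt_wfRel.wf)

theorem rankLT_of_degLex {b c : List (List ℕ)} (h : DegLex c.flatten b.flatten) :
    RankLT k c b := Prod.Lex.left _ _ h

theorem Matched.rankLT {b c : List (List ℕ)} (h : Matched k b c) : RankLT k b c := by
  have hv : IsVertex k b := h.choose_spec.choose_spec.choose_spec.choose_spec.2.2.1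
  have hlen := h.length
  obtain ⟨α, p, q, r, hb, hc, -, hcv, hα, hn, hp⟩ := h
  have hfl : b.flatten = c.flatten := by rw [hb, hc]; simp
  have h1 : α.length + 1 ≤ prefixLength k b := by
    have := le_prefixLength (r := q :: r) hp
    rw [hb]
    simpa using this
  have h2 : prefixLength k c ≤ α.length := by
    by_contra! hlt
    have := isAnickChain_take_prefixLength (k := k) c
    obtain ⟨m, hm⟩ : ∃ m, prefixLength k c = α.length + 1 + m := Nat.exists_eq_add_of_le hlt
    rw [hm, hc] at this
    refine hn (IsAnickChain.of_append (c := r.take m) ?_)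
    rw [List.take_append, show α.length + 1 + m - α.length = m + 1 by omega,
      List.take_of_length_le (by omega), List.take_succ_cons] at this
    simpa using this
  have h3 := prefixLength_le_length (k := k) b
  have h4 := length_le_length_flatten hv
  unfold RankLT pathRank
  rw [← hfl]
  refine Prod.Lex.right _ ?_
  omega

theorem morseWeight_ne_zero {b c : List (List ℕ)} (h : morseWeight k b c ≠ 0) :
    Matched k c b ∨ (¬ Matched k b c ∧ barD k b c ≠ 0) := by
  classical
  unfold morseWeight at h
  split_ifs at h with h1 h2
  · exact Or.inl h1
  · exact absurd rfl h
  · exact Or.inr ⟨h2, h⟩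

theorem isPath_cons {b c : List (List ℕ)} {l : List (List (List ℕ))} :
    IsPath k b (c :: l) ↔ morseWeight k b c ≠ 0 ∧ IsPath k c l :=
  List.isChain_cons_cons

variable [CharZero k]

theorem rankLT_of_innerD {b c : List (List ℕ)} (hb : IsVertex k b) (h : innerD k b c ≠ 0)
    (hm : ¬ Matched k b c) : RankLT k c b := by
  obtain ⟨hc, hlen⟩ := hb.of_innerD h
  obtain ⟨u, x, y, r, z, rfl, rfl, hz⟩ := exists_of_innerD_ne_zero h
  obtain ⟨hzn, rfl | hlt⟩ := nfMul_support hz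
  · have hfl : (u ++ (x ++ y) :: r).flatten = (u ++ x :: y :: r).flatten := by simp
    have hx := (hb x (by simp)).1
    have hy := (hb y (by simp)).1
    -- the initial Anick chain ends before the two words that are merged
    have hpre : prefixLength k (u ++ x :: y :: r) ≤ prefixLength k (u ++ (x ++ y) :: r) := by
      set m := prefixLength k (u ++ x :: y :: r) with hm_def
      have hch : IsAnickChain k ((u ++ x :: y :: r).take m) := isAnickChain_take_prefixLength _
      rcases Nat.lt_or_ge u.length m with hum | hum
      · exfalso
        obtain ⟨d, hd⟩ : ∃ d, m = u.length + 1 + d := ⟨_, (by omega : _ = _ + (m - (u.length + 1)))⟩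
        rw [hd, List.take_append, show u.length + 1 + d - u.length = d + 1 by omega,
          List.take_of_length_le (by omega), List.take_succ_cons] at hch
        cases d with
        | zero =>
          rw [List.take_zero] at hch
          exact hm ⟨u, x, y, r, rfl, rfl, hb, hc, hch.of_append,
            not_isAnickChain_of_two_le hx hy, hch⟩
        | succ d =>
          rw [List.take_succ_cons] at hch
          exact hch.not_normal hzn
      · rw [List.take_append_of_le_length hum] at hch
        have := le_prefixLength (r := u.drop m ++ (x ++ y) :: r) hch
        rw [← List.append_assoc, List.take_append_drop, List.length_take, min_eq_left hum] at this
        exact this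
    unfold RankLT pathRank
    rw [hfl]
    refine Prod.Lex.right _ ?_
    omega
  · refine rankLT_of_degLex ?_
    have := degLex_append_append hlt u.flatten r.flatten
    simpa using this

theorem rankLT_of_barD {b c : List (List ℕ)} (hb : IsVertex k b) (h : barD k b c ≠ 0)
    (hm : ¬ Matched k b c) : RankLT k c b := by
  rcases exists_of_barD_ne_zero h with ⟨x, rfl⟩ | ⟨x, rfl⟩ | h
  · have := List.length_pos_iff.2 (hb x (by simp)).1
    refine rankLT_of_degLex (List.Shortlex.of_length_lt ?_)
    simp only [List.flatten_cons, List.length_append]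
    omega
  · have := List.length_pos_iff.2 (hb x (by simp)).1
    refine rankLT_of_degLex (List.Shortlex.of_length_lt ?_)
    simp only [List.flatten_append, List.length_append, List.flatten_cons, List.flatten_nil,
      List.length_nil]
    omega
  · exact rankLT_of_innerD hb h hm

theorem IsVertex.of_morseWeight {b c : List (List ℕ)} (hb : IsVertex k b)
    (h : morseWeight k b c ≠ 0) : IsVertex k c := by
  rcases morseWeight_ne_zero h with h | ⟨-, h⟩
  · exact h.choose_spec.choose_spec.choose_spec.choose_spec.2.2.1
  · exact (hb.of_barD h).1

theorem rankLT_of_morseWeight {b c : List (List ℕ)} (hb : IsVertex k b)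
    (h : morseWeight k b c ≠ 0) : RankLT k c b := by
  rcases morseWeight_ne_zero h with h | ⟨hm, h⟩
  · exact h.rankLT
  · exact rankLT_of_barD hb h hm

theorem finite_setOf_morseWeight_ne_zero (b : List (List ℕ)) :
    {c | morseWeight k b c ≠ 0}.Finite := by
  have h1 : {c | Matched k c b}.Finite :=
    Set.Subsingleton.finite fun _ h _ h' => Matched.unique_left h h'
  refine (h1.union (barD k b).support.finite_toSet).subset fun c hc => ?_
  rcases morseWeight_ne_zero hc with h | ⟨-, h⟩
  · exact Or.inl h
  · exact Or.inr (Finset.mem_coe.2 (Finsupp.mem_support_iff.2 h))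

theorem finite_setOf_isPath {b : List (List ℕ)} (hb : IsVertex k b) :
    {l | IsPath k b l}.Finite := by
  induction b using (rankLT_wf k).induction with
  | _ b ih =>
    have hfin := (finite_setOf_morseWeight_ne_zero (k := k) b).biUnion
      (t := fun c => (fun l => c :: l) '' {l | IsPath k c l})
      (fun c hc => (ih c (rankLT_of_morseWeight hb hc) (hb.of_morseWeight hc)).image _)
    refine (hfin.insert []).subset fun l hl => ?_
    cases l with
    | nil => exact Or.inl rfl
    | cons c l =>
      obtain ⟨h1, h2⟩ := isPath_cons.1 hl
      exact Or.inr (Set.mem_biUnion h1 ⟨l, h2, rfl⟩)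

/-- The first-step decomposition of the sum over paths. -/
theorem gam_eq_sum {b : List (List ℕ)} (hb : IsVertex k b)
    (a : List (List ℕ)) (T : Finset (List (List ℕ))) (hT : ∀ c, morseWeight k b c ≠ 0 → c ∈ T) :
    Gam k b a = (if b = a then 1 else 0) + ∑ c ∈ T, morseWeight k b c * Gam k c a := by
  have hset : {l | IsPath k b l ∧ l.getLastD b = a} =
      {l | l = [] ∧ b = a} ∪ ⋃ c ∈ {c | morseWeight k b c ≠ 0},
        (fun l => c :: l) '' {l | IsPath k c l ∧ l.getLastD c = a} := by
    ext l
    cases l with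
    | nil => simp [IsPath]
    | cons c l =>
      rw [Set.mem_ofPred_eq, isPath_cons]
      simp only [List.getLastD_cons]
      simp [and_assoc, and_comm]
  have hfin : ∀ c ∈ {c | morseWeight k b c ≠ 0}, {l | IsPath k c l ∧ l.getLastD c = a}.Finite :=
    fun c hc => (finite_setOf_isPath (hb.of_morseWeight hc)).subset fun _ h => h.1
  have hsucc := finite_setOf_morseWeight_ne_zero (k := k) b
  have hstep : ∀ c, ∑ᶠ l ∈ (fun l => c :: l) '' {l | IsPath k c l ∧ l.getLastD c = a},
      pathWeight k b l = morseWeight k b c * Gam k c a := by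
    intro c
    rw [finsum_mem_image (fun _ _ _ _ h => (List.cons_eq_cons.1 h).2)]
    by_cases hc : morseWeight k b c = 0
    · simp [pathWeight, hc]
    · rw [Gam, mul_finsum_mem' _ _ (hfin c hc)]
      rfl
  rw [Gam, hset, finsum_mem_union]
  · congr 1
    · by_cases hba : b = a
      · simp [hba, pathWeight]
      · simp [hba]
    · rw [finsum_mem_biUnion]
      · simp_rw [hstep]
        refine finsum_mem_eq_sum_of_inter_support_eq _ (Set.ext fun c => ?_)
        simp only [Set.mem_inter_iff, and_congr_left_iff, Finset.mem_coe]
        intro hc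
        have hc' : morseWeight k b c ≠ 0 := left_ne_zero_of_mul hc
        exact ⟨fun _ => hT c hc', fun _ => hc'⟩
      · intro c _ c' _ hcc'
        rw [Function.onFun, Set.disjoint_left]
        rintro _ ⟨l, -, rfl⟩ ⟨l', -, h⟩
        exact hcc' (List.cons_eq_cons.1 h).1.symm
      · exact hsucc
      · exact fun c hc => (hfin c hc).image _
  · rw [Set.disjoint_left]
    rintro _ ⟨rfl, -⟩ h
    simp at h
  · exact (Set.finite_singleton []).subset fun l h => h.1
  · exact hsucc.biUnion fun c hc => (hfin c hc).image _

end Finiteness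

/-! ### The augmented path sums -/

section AugGam

theorem neg_one_pow_mul_self {R : Type*} [Ring R] (m : ℕ) : (-1 : R) ^ m * (-1) ^ m = 1 := by
  rw [← pow_add, ← two_mul, pow_mul, neg_one_sq, one_pow]

variable {k : Type u} [Field k]

theorem envAug_ev_tmul {w : List ℕ} (h : w ≠ []) (y : (Lam k)ᵐᵒᵖ) :
    envAug k (ev k w ⊗ₜ[k] y) = 0 := by
  simp [envAug, aug_ev_of_ne_nil h]

theorem envAug_tmul_ev {w : List ℕ} (h : w ≠ []) (x : Lam k) :
    envAug k (x ⊗ₜ[k] MulOpposite.op (ev k w)) = 0 := by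
  simp [envAug, aug_ev_of_ne_nil h]

/-- Only the inner part of the bar differential survives the augmentation. -/
theorem envAug_barD {b : List (List ℕ)} (hb : IsVertex k b) (c : List (List ℕ)) :
    envAug k (barD k b c) = innerD k b c := by
  classical
  cases b with
  | nil => simp [barD, innerD]
  | cons x r =>
    have h1 := envAug_ev_tmul (hb x (by simp)).1 (1 : (Lam k)ᵐᵒᵖ)
    have h2 := envAug_tmul_ev
      (hb _ (List.getLast_mem (List.cons_ne_nil x r))).1 (1 : Lam k)
    rw [barD, Finsupp.add_apply, Finsupp.add_apply, Finsupp.mapRange_apply, Finsupp.single_apply,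
      Finsupp.single_apply, map_add, map_add, AlgHom.commutes]
    have h3 : envAug k (if r = c then ev k x ⊗ₜ[k] 1 else 0) = 0 := by
      split_ifs
      · exact h1
      · exact map_zero _
    have h4 : envAug k (if (x :: r).dropLast = c then (-1) ^ (r.length + 1)
        * (1 ⊗ₜ[k] MulOpposite.op (ev k ((x :: r).getLast (List.cons_ne_nil x r)))) else 0)
        = 0 := by
      split_ifs
      · rw [map_mul, h2, mul_zero]
      · exact map_zero _
    rw [h3, h4]
    simp

variable (k) in
/-- The image of `Γ(c, a)` under the augmentation. -/
noncomputable def augGam (a c : List (List ℕ)) : k := envAug k (Gam k c a)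

variable (k) in
/-- The linear extension of `c ↦ augGam k a c`. -/
noncomputable def augGamLin (a : List (List ℕ)) : (List (List ℕ) →₀ k) →ₗ[k] k :=
  Finsupp.linearCombination k (augGam k a)

theorem augGamLin_eq_sum (a : List (List ℕ)) (f : List (List ℕ) →₀ k) (T : Finset (List (List ℕ)))
    (hT : f.support ⊆ T) : augGamLin k a f = ∑ c ∈ T, f c * augGam k a c := by
  rw [augGamLin, Finsupp.linearCombination_apply, Finsupp.sum_of_support_subset _ hT] <;> simp

variable [CharZero k] {a : List (List ℕ)}

theorem augGam_eq_sum {b : List (List ℕ)} (hb : IsVertex k b) (a : List (List ℕ)) :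
    ∃ T : Finset (List (List ℕ)), (innerD k b).support ⊆ T ∧ (∀ c, Matched k c b → c ∈ T) ∧
      augGam k a b = (if b = a then 1 else 0)
        + ∑ c ∈ T, envAug k (morseWeight k b c) * augGam k a c := by
  classical
  have hfin := finite_setOf_morseWeight_ne_zero (k := k) b
  have hm : {c | Matched k c b}.Finite :=
    Set.Subsingleton.finite fun _ h _ h' => Matched.unique_left h h'
  refine ⟨hfin.toFinset ∪ hm.toFinset ∪ (innerD k b).support,
    Finset.subset_union_right, ?_, ?_⟩
  · intro c hc; simp [hc]
  · rw [augGam, gam_eq_sum hb a (hfin.toFinset ∪ hm.toFinset ∪ (innerD k b).support), map_add,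
      map_sum]
    · congr 1
      · split_ifs <;> simp
      · simp [augGam]
    · intro c hc; simp [hc]

/-- A path to `a` must enter `a` from a vertex with one more entry, because the upper ends of
reversed edges are not critical. -/
theorem augGam_of_length_le (ha : IsAnickChain k a) {c : List (List ℕ)} (hc : IsVertex k c) :
    (c.length < a.length → augGam k a c = 0) ∧
    (c.length = a.length → (∀ b, ¬ Matched k b c) → augGam k a c = if c = a then 1 else 0) := by
  induction c using (rankLT_wf k).induction with
  | _ c ih =>
    obtain ⟨T, -, -, hT⟩ := augGam_eq_sum hc a
    constructor
    · intro hlt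
      rw [hT, if_neg (by rintro rfl; exact lt_irrefl _ hlt), zero_add]
      refine Finset.sum_eq_zero fun d _ => ?_
      by_cases hw : morseWeight k c d = 0
      · rw [hw, map_zero, zero_mul]
      · have hd := ih d (rankLT_of_morseWeight hc hw) (hc.of_morseWeight hw)
        refine mul_eq_zero_of_right _ ?_
        rcases morseWeight_ne_zero hw with h | ⟨-, h⟩
        · have hl := h.length
          rcases Nat.lt_or_ge d.length a.length with hda | hda
          · exact hd.1 hda
          · rw [hd.2 (by omega) fun b => h.not_matched_left,
              if_neg (by rintro rfl; exact ha.not_matched_left h)]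
        · have hl := (hc.of_barD h).2
          exact hd.1 (by omega)
    · intro heq hno
      rw [hT, add_eq_left]
      refine Finset.sum_eq_zero fun d _ => ?_
      by_cases hw : morseWeight k c d = 0
      · rw [hw, map_zero, zero_mul]
      · have hd := ih d (rankLT_of_morseWeight hc hw) (hc.of_morseWeight hw)
        refine mul_eq_zero_of_right _ ?_
        rcases morseWeight_ne_zero hw with h | ⟨-, h⟩
        · exact absurd h (hno d)
        · have hl := (hc.of_barD h).2
          exact hd.1 (by omega)

theorem augGam_of_not_matched (ha : IsAnickChain k a) {c : List (List ℕ)} (hc : IsVertex k c)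
    (hl : c.length = a.length) (hno : ∀ b, ¬ Matched k b c) :
    augGam k a c = if c = a then 1 else 0 :=
  (augGam_of_length_le ha hc).2 hl hno

theorem augGam_of_matched (ha : IsAnickChain k a) {b c : List (List ℕ)} (h : Matched k b c)
    (hc : IsVertex k c) (hl : c.length = a.length) :
    augGam k a c = envAug k (morseWeight k c b) * augGam k a b := by
  obtain ⟨T, -, hTm, hT⟩ := augGam_eq_sum hc a
  rw [hT, if_neg (by rintro rfl; exact ha.not_matched_right h), zero_add,
    Finset.sum_eq_single_of_mem b (hTm b h)]
  intro d _ hdb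
  by_cases hw : morseWeight k c d = 0
  · rw [hw, map_zero, zero_mul]
  · refine mul_eq_zero_of_right _ ?_
    rcases morseWeight_ne_zero hw with h' | ⟨-, h'⟩
    · exact absurd (Matched.unique_left h' h) hdb
    · have := (hc.of_barD h').2
      exact (augGam_of_length_le ha (hc.of_morseWeight hw)).1 (by omega)

/-- The path sums vanish on the boundary of the upper end of a matched edge: the boundary term at
the lower end cancels against all others. This determines the path sums recursively. -/
theorem augGamLin_innerD_of_matched (ha : IsAnickChain k a) {b c : List (List ℕ)}
    (h : Matched k b c) (hl : b.length = a.length + 1) : augGamLin k a (innerD k b) = 0 := by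
  have hlen := h.length
  have hm := h
  obtain ⟨u, p, q, r, rfl, rfl, hb, hc, -, -, -⟩ := h
  have hp := (hb p (by simp)).1
  have hq := (hb q (by simp)).1
  have hpq : Normal k (p ++ q) := (hc _ (by simp)).2
  set b := u ++ p :: q :: r
  set c := u ++ (p ++ q) :: r
  obtain ⟨T, hTs, -, hT⟩ := augGam_eq_sum hb a
  have hca := augGam_of_matched ha hm hc (by omega)
  have hsign : ((-1 : k) ^ (u.length + 1)) * (-1) ^ (u.length + 1) = 1 :=
    neg_one_pow_mul_self _
  have hsignE : ((-1 : Env k) ^ (u.length + 1)) * (-1) ^ (u.length + 1) = 1 :=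
    neg_one_pow_mul_self (R := Env k) _
  have hbarD : barD k b c = (-1) ^ (u.length + 1) := barD_matched hp hq hpq u r
  have hinner : innerD k b c = (-1) ^ (u.length + 1) := innerD_matched hp hq hpq u r
  have hup : envAug k (morseWeight k c b) = -(-1) ^ (u.length + 1) := by
    have hinv : Ring.inverse ((-1 : Env k) ^ (u.length + 1)) = (-1) ^ (u.length + 1) :=
      Ring.inverse_unit (⟨_, _, hsignE, hsignE⟩ : (Env k)ˣ)
    rw [morseWeight, if_pos hm, hbarD, hinv]
    refine (map_neg (envAug k) _).trans (congrArg Neg.neg ?_)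
    rw [map_pow]
    exact congrArg (· ^ (u.length + 1)) ((map_neg (envAug k) _).trans (by rw [map_one]))
  have hdown : ∀ d, envAug k (morseWeight k b d) * augGam k a d
      = innerD k b d * augGam k a d - if d = c then innerD k b c * augGam k a c else 0 := by
    intro d
    rw [morseWeight, if_neg hm.not_matched_left]
    by_cases hd : d = c
    · subst hd
      rw [if_pos hm, if_pos rfl]; simp
    · rw [if_neg fun h' => hd (Matched.unique_right h' hm), if_neg hd, envAug_barD hb, sub_zero]
  simp only [hdown] at hT
  rw [if_neg (by rintro h'; rw [h'] at hl; omega), zero_add, Finset.sum_sub_distrib,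
    ← augGamLin_eq_sum a _ T hTs, Finset.sum_ite_eq', if_pos] at hT
  · rw [hca, hup, hinner] at hT
    linear_combination -hT - augGam k a b * hsign
  · refine hTs (Finsupp.mem_support_iff.2 ?_)
    rw [hinner]
    exact left_ne_zero_of_mul_eq_one hsign

/-- The path sums from a critical vertex. -/
theorem augGam_of_isAnickChain {b : List (List ℕ)} (hb : IsAnickChain k b)
    (hl : b.length = a.length + 1) : augGam k a b = augGamLin k a (innerD k b) := by
  obtain ⟨T, hTs, -, hT⟩ := augGam_eq_sum hb.isVertex a
  rw [hT, if_neg (by rintro h'; rw [h'] at hl; omega), zero_add, augGamLin_eq_sum a _ T hTs]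
  refine Finset.sum_congr rfl fun d _ => ?_
  rw [morseWeight, if_neg hb.not_matched_right, if_neg hb.not_matched_left,
    envAug_barD hb.isVertex]

end AugGam

/-! ### Expansion of the inner differential from the left -/

section Expansion

variable {k : Type u} [Field k]

variable (k) in
/-- The path sum of the boundary of `L`, with the entries `u` put in front. -/
noncomputable def innerSum (a u L : List (List ℕ)) : k :=
  augGamLin k a ((innerD k L).mapDomain (fun c => u ++ c))

variable (k) in
/-- The path sum of the combination of tuples `[u|xy|r]` that arises by expanding `xy`. -/
noncomputable def mergeVal (a u : List (List ℕ)) (x y : List ℕ) (r : List (List ℕ)) : k :=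
  augGamLin k a ((nfMul k x y).mapDomain (fun z => u ++ z :: r))

variable {a : List (List ℕ)}

theorem innerSum_nil (L : List (List ℕ)) : innerSum k a [] L = augGamLin k a (innerD k L) := by
  exact congrArg _ Finsupp.mapDomain_id

theorem innerSum_singleton (u : List (List ℕ)) (x : List ℕ) : innerSum k a u [x] = 0 := by
  simp [innerSum, innerD]

theorem innerSum_cons_cons (u : List (List ℕ)) (x y : List ℕ) (r : List (List ℕ)) :
    innerSum k a u (x :: y :: r) = -mergeVal k a u x y r - innerSum k a (u ++ [x]) (y :: r) := by
  have hneg : ∀ g : List (List ℕ) →₀ k, (-g).mapDomain (fun c => u ++ c)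
      = -g.mapDomain (fun c => u ++ c) := map_neg (Finsupp.mapDomain.addMonoidHom _)
  rw [innerSum, innerD, Finsupp.mapDomain_sub, hneg, ← Finsupp.mapDomain_comp,
    ← Finsupp.mapDomain_comp, map_sub, map_neg, mergeVal, innerSum]
  have : ((fun c => u ++ c) ∘ fun c => x :: c) = fun c => (u ++ [x]) ++ c := by
    ext1 c; simp
  rw [this]
  rfl

theorem mergeVal_of_normal {x y : List ℕ} (h : Normal k (x ++ y)) (u r : List (List ℕ)) :
    mergeVal k a u x y r = augGam k a (u ++ (x ++ y) :: r) := by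
  simp [mergeVal, nfMul_of_normal h, augGamLin, Finsupp.mapDomain_single]

variable [CharZero k]

theorem innerSum_eq_zero {u L : List (List ℕ)} (hL : IsVertex k L)
    (h : ∀ w t, IsVertex k (w :: t) → L.length = t.length + 2 → augGam k a (u ++ w :: t) = 0) :
    innerSum k a u L = 0 := by
  rw [innerSum, augGamLin, Finsupp.linearCombination_mapDomain, Finsupp.linearCombination_apply]
  refine Finset.sum_eq_zero fun c hc => ?_
  obtain ⟨h1, h2⟩ := hL.of_innerD (Finsupp.mem_support_iff.1 hc)
  obtain ⟨w, t, rfl⟩ : ∃ w t, c = w :: t := by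
    obtain ⟨v, x, y, r, z, -, rfl, -⟩ := exists_of_innerD_ne_zero (Finsupp.mem_support_iff.1 hc)
    exact List.exists_cons_of_ne_nil (by simp)
  simp [h w t h1 (by simpa using h2)]

theorem mergeVal_letters {n : ℕ} (hn : 2 ≤ n) (m : ℕ) (u r : List (List ℕ)) :
    mergeVal k a u [n] [m] r =
      -(((n : k) - 1) * ((m : k) - 1) / ((n : k) + (m : k) - 1))
        * augGam k a (u ++ [0, n + m] :: r)
      + ((n : k) * (m : k) / ((n : k) + (m : k) - 1)) * augGam k a (u ++ [1, n + m - 1] :: r)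
      + ((n : k) * ((n : k) - 1) / ((n : k) + (m : k) - 1))
        * augGam k a (u ++ [n + m - 1] :: r) := by
  rw [mergeVal, nfMul_letters hn]
  simp [augGamLin, Finsupp.mapDomain_add, Finsupp.mapDomain_single]

theorem mergeVal_one_zero (u r : List (List ℕ)) :
    mergeVal k a u [1] [0] r =
      augGam k a (u ++ [0, 1] :: r) + augGam k a (u ++ [0] :: r) := by
  rw [mergeVal, nfMul_one_zero]
  simp [augGamLin, Finsupp.mapDomain_add, Finsupp.mapDomain_single]

end Expansion

/-! ### Tuples of letters -/

section Letters

/-- The tuple `[i_s|…|i_{s+l-1}]` of letters. -/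
def seg (i : ℕ → ℕ) (s l : ℕ) : List (List ℕ) := (List.range' s l).map (fun t => [i t])

theorem letters_eq_seg (n : ℕ) (i : ℕ → ℕ) : letters n i = seg i 1 n := by
  rw [letters, seg, List.range'_eq_map_range, List.map_map]
  refine List.map_congr_left fun t _ => ?_
  simp [add_comm]

theorem seg_zero (i : ℕ → ℕ) (s : ℕ) : seg i s 0 = [] := rfl

theorem seg_succ (i : ℕ → ℕ) (s l : ℕ) : seg i s (l + 1) = [i s] :: seg i (s + 1) l := by
  simp [seg, List.range'_succ]

theorem seg_append (i : ℕ → ℕ) (s l m : ℕ) : seg i s l ++ seg i (s + l) m = seg i s (l + m) := by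
  rw [seg, seg, seg, ← List.map_append, ← List.range'_append, one_mul]

theorem seg_concat (i : ℕ → ℕ) (s l : ℕ) : seg i s (l + 1) = seg i s l ++ [[i (s + l)]] := by
  rw [← seg_append]
  rfl

theorem length_seg (i : ℕ → ℕ) (s l : ℕ) : (seg i s l).length = l := by simp [seg]

theorem seg_congr {i j : ℕ → ℕ} {s l : ℕ} (h : ∀ t, s ≤ t → t < s + l → i t = j t) :
    seg i s l = seg j s l := by
  refine List.map_congr_left fun t ht => ?_
  rw [List.mem_range'_1] at ht
  rw [h t ht.1 ht.2]

theorem length_of_mem_seg {i : ℕ → ℕ} {s l : ℕ} {w : List ℕ} (h : w ∈ seg i s l) :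
    w.length = 1 := by
  obtain ⟨t, -, rfl⟩ := List.mem_map.1 h
  rfl

variable {k : Type u} [Field k]

/-- The part of a vertex that consists of letters is not split. -/
theorem Matched.exists_of_append {u s b : List (List ℕ)} (hu : ∀ w ∈ u, w.length = 1)
    (h : Matched k b (u ++ s)) :
    ∃ v p q r, s = v ++ (p ++ q) :: r ∧ p ≠ [] ∧ q ≠ [] ∧ IsAnickChain k (u ++ (v ++ [p])) := by
  obtain ⟨α, p, q, r, rfl, hc, hb, -, -, -, hp⟩ := h
  have hp0 := (hb p (by simp)).1
  have hq0 := (hb q (by simp)).1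
  rcases List.append_eq_append_iff.1 hc with ⟨as, rfl, h2⟩ | ⟨as, rfl, h2⟩
  · exact ⟨as, p, q, r, h2, hp0, hq0, by simpa using hp⟩
  · cases as with
    | nil =>
      exact ⟨[], p, q, r, by simpa using h2.symm, hp0, hq0, by simpa using hp⟩
    | cons x as =>
      obtain ⟨h3, -⟩ := List.cons_eq_cons.1 h2
      have h4 := hu x (by simp)
      have h5 := List.length_pos_iff.2 hp0
      have h6 := List.length_pos_iff.2 hq0
      rw [← h3, List.length_append] at h4
      omega

theorem not_matched_of_length_eq_one {b c : List (List ℕ)} (hc : ∀ w ∈ c, w.length = 1) :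
    ¬ Matched k b c := by
  intro h
  rw [← List.append_nil c] at h
  obtain ⟨v, p, q, r, h1, -⟩ := h.exists_of_append hc
  simp at h1

variable [CharZero k]

theorem isVertex_of_length_eq_one {c : List (List ℕ)} (h : ∀ w ∈ c, w.length = 1) :
    IsVertex k c := by
  intro w hw
  have := h w hw
  exact ⟨by rintro rfl; simp at this, normal_of_length_le_one this.le⟩

theorem IsAnickChain.cons {j : ℕ} (hj : 2 ≤ j) {c : List (List ℕ)} (h : IsAnickChain k c) :
    IsAnickChain k ([j] :: c) := by
  obtain ⟨js, rfl, hjs⟩ := isAnickChain_iff.1 h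
  refine isAnickChain_iff.2 ⟨j :: js, rfl, ?_⟩
  cases js with
  | nil => simp
  | cons m js => exact List.isChain_cons_cons.2 ⟨not_allowed_iff.2 (Or.inl hj), hjs⟩

theorem IsAnickChain.seg_append {i : ℕ → ℕ} {s l : ℕ} (hi : ∀ t, s ≤ t → t < s + l → 2 ≤ i t)
    {c : List (List ℕ)} (h : IsAnickChain k c) : IsAnickChain k (seg i s l ++ c) := by
  induction l generalizing s with
  | zero => exact h
  | succ l ih =>
    rw [seg_succ]
    exact (ih fun t h1 h2 => hi t (by omega) (by omega)).cons (hi s le_rfl (by omega))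

theorem isAnickChain_singleton (x : ℕ) : IsAnickChain k [[x]] :=
  isAnickChain_iff.2 ⟨[x], rfl, by simp⟩

theorem isAnickChain_one_zero : IsAnickChain k [[1], [0]] :=
  isAnickChain_iff.2 ⟨[1, 0], rfl, by simp [Allowed]⟩

theorem normal_zero_append {w : List ℕ} (h : Normal k w) : Normal k ([0] ++ w) := by
  rw [normal_iff] at *
  cases w with
  | nil => simp
  | cons y w => exact List.isChain_cons_cons.2 ⟨Or.inl rfl, h⟩

theorem normal_one_pair {y : ℕ} (hy : y ≠ 0) : Normal k ([1] ++ [y]) := by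
  rw [normal_iff, List.singleton_append, List.isChain_pair]
  exact Or.inr ⟨rfl, hy⟩

/-- Nothing behind a normal pair is split. -/
theorem not_matched_of_normal {u r b : List (List ℕ)} {x : ℕ} {w : List ℕ}
    (hu : ∀ w ∈ u, w.length = 1) (hw : Normal k ([x] ++ w)) :
    ¬ Matched k b (u ++ [x] :: w :: r) := by
  intro h
  obtain ⟨v, p, q, s, h1, hp, hq, h2⟩ := h.exists_of_append hu
  match v with
  | [] =>
    obtain ⟨h3, -⟩ := List.cons_eq_cons.1 h1
    have h4 := congrArg List.length h3
    have h5 := List.length_pos_iff.2 hp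
    have h6 := List.length_pos_iff.2 hq
    rw [List.length_append] at h4
    simp at h4
    omega
  | [y] =>
    simp only [List.cons_append, List.nil_append, List.cons.injEq] at h1
    obtain ⟨rfl, rfl, -⟩ := h1
    rw [← List.append_assoc] at hw
    exact IsAnickChain.not_normal (r := []) h2 (normal_of_append_left hw)
  | y :: z :: v =>
    simp only [List.cons_append, List.cons.injEq] at h1
    obtain ⟨rfl, rfl, -⟩ := h1
    exact IsAnickChain.not_normal (u := u) (r := v ++ [p]) h2 hw

variable {a : List (List ℕ)}

theorem augGam_of_length_eq_one (ha : IsAnickChain k a) {c : List (List ℕ)}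
    (hc : ∀ w ∈ c, w.length = 1) (hl : c.length = a.length) :
    augGam k a c = if c = a then 1 else 0 :=
  augGam_of_not_matched ha (isVertex_of_length_eq_one hc) hl
    fun _ => not_matched_of_length_eq_one hc

theorem augGam_eq_zero_of_normal (ha : IsAnickChain k a) {u r : List (List ℕ)} {x : ℕ} {w : List ℕ}
    (hu : ∀ w ∈ u, w.length = 1) (hv : IsVertex k (w :: r)) (hw : Normal k ([x] ++ w))
    (hl : (u ++ [x] :: w :: r).length = a.length) :
    augGam k a (u ++ [x] :: w :: r) = 0 := by
  rw [augGam_of_not_matched ha _ hl fun _ => not_matched_of_normal hu hw, if_neg]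
  · rintro rfl
    exact ha.not_normal hw
  · exact IsVertex.append.2 ⟨isVertex_of_length_eq_one hu,
      IsVertex.cons.2 ⟨⟨by simp, normal_of_length_le_one (by simp)⟩, hv⟩⟩

theorem matched_of_isAnickChain {u r : List (List ℕ)} {x : ℕ} {y : List ℕ}
    (hu : IsAnickChain k (u ++ [[x]])) (hr : IsVertex k (y :: r)) (hy : Normal k ([x] ++ y)) :
    Matched k (u ++ [x] :: y :: r) (u ++ ([x] ++ y) :: r) := by
  obtain ⟨⟨hy0, hyn⟩, hr⟩ := IsVertex.cons.1 hr
  have huv := hu.of_append.isVertex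
  refine ⟨u, [x], y, r, rfl, rfl, ?_, ?_, hu.of_append,
    not_isAnickChain_of_two_le (by simp) hy0, hu⟩
  · exact IsVertex.append.2 ⟨huv, IsVertex.cons.2
      ⟨⟨by simp, normal_of_length_le_one (by simp)⟩, IsVertex.cons.2 ⟨⟨hy0, hyn⟩, hr⟩⟩⟩
  · exact IsVertex.append.2 ⟨huv, IsVertex.cons.2 ⟨⟨by simp, hy⟩, hr⟩⟩

theorem innerSum_of_isAnickChain (ha : IsAnickChain k a) {u r : List (List ℕ)} {x : ℕ} {y : List ℕ}
    (hu : IsAnickChain k (u ++ [[x]])) (hr : IsVertex k (y :: r)) (hy : Normal k ([x] ++ y))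
    (hl : u.length + r.length + 1 = a.length) :
    innerSum k a [] (u ++ [x] :: y :: r) = 0 := by
  rw [innerSum_nil]
  exact augGamLin_innerD_of_matched ha (matched_of_isAnickChain hu hr hy) (by simp; omega)

end Letters

section SegExpansion

variable {k : Type u} [Field k]

/-- The boundary of a tuple that begins with letters, expanded over the merged pairs of letters. -/
theorem innerSum_seg (a : List (List ℕ)) (i : ℕ → ℕ) (l : ℕ) (T : List (List ℕ)) :
    innerSum k a [] (seg i 1 (l + 1) ++ T) =
      ∑ t ∈ Finset.range l, (-1) ^ (t + 1) *
        mergeVal k a (seg i 1 t) [i (t + 1)] [i (t + 2)] (seg i (t + 3) (l - 1 - t) ++ T)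
      + (-1) ^ l * innerSum k a (seg i 1 l) ([i (l + 1)] :: T) := by
  induction l generalizing T with
  | zero => simp [seg]
  | succ l ih =>
    rw [seg_concat, List.append_assoc, List.singleton_append, ih, innerSum_cons_cons,
      Finset.sum_range_succ, seg_concat i 1 l]
    have h : ∀ t ∈ Finset.range l,
        (-1 : k) ^ (t + 1) * mergeVal k a (seg i 1 t) [i (t + 1)] [i (t + 2)]
          (seg i (t + 3) (l - 1 - t) ++ [i (1 + (l + 1))] :: T)
        = (-1) ^ (t + 1) * mergeVal k a (seg i 1 t) [i (t + 1)] [i (t + 2)]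
          (seg i (t + 3) (l + 1 - 1 - t) ++ T) := by
      intro t ht
      rw [Finset.mem_range] at ht
      rw [show l + 1 - 1 - t = l - 1 - t + 1 by omega, seg_concat,
        show t + 3 + (l - 1 - t) = 1 + (l + 1) by omega]
      simp
    rw [Finset.sum_congr rfl h, show 1 + (l + 1) = l + 2 by omega, show 1 + l = l + 1 by omega,
      show l + 1 - 1 - l = 0 by omega, seg_zero, List.nil_append]
    ring

end SegExpansion

/-! ### The path sums of the split tuples -/

section Formulas

variable (k : Type u) [Field k]

/-- The formula `Γ([i₁|…|i_l|0 y|R], a) = ∑_t i_t [i₁|…|i_t - 1|…|i_l|y|R](a)`. -/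
def LowerFormula (a : List (List ℕ)) (l : ℕ) : Prop :=
  ∀ (i : ℕ → ℕ) (y : ℕ) (R : List (List ℕ)), (∀ t, 1 ≤ t → t < 1 + l → 2 ≤ i t) → 1 ≤ y →
    (∀ w ∈ R, w.length = 1) → l + R.length + 1 = a.length →
    augGam k a (seg i 1 l ++ [0, y] :: R) =
      ∑ t ∈ Finset.Icc 1 l, (i t : k) * if seg (lower i t) 1 l ++ [y] :: R = a then 1 else 0

/-- The formula `Γ([i₁|…|i_l|1 y|R], a) = ∑_t (i_t - 1) [i₁|…|i_l|y|R](a)`. -/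
def ScaleFormula (a : List (List ℕ)) (l : ℕ) : Prop :=
  ∀ (i : ℕ → ℕ) (y : ℕ) (R : List (List ℕ)), (∀ t, 1 ≤ t → t < 1 + l → 2 ≤ i t) → 2 ≤ y →
    (∀ w ∈ R, w.length = 1) → l + R.length + 1 = a.length →
    augGam k a (seg i 1 l ++ [1, y] :: R) =
      ∑ t ∈ Finset.Icc 1 l, ((i t : k) - 1) * if seg i 1 l ++ [y] :: R = a then 1 else 0

variable {k} {a : List (List ℕ)}

theorem append_ne_of_normal (ha : IsAnickChain k a) {x y : List ℕ} (h : Normal k (x ++ y))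
    (v r : List (List ℕ)) : v ++ x :: y :: r ≠ a := by
  rintro rfl
  exact ha.not_normal h

variable [CharZero k]

/-- The contribution of the merging of two letters behind `[i₁|…|i_l]`. -/
theorem mergeVal_eq (ha : IsAnickChain k a) {l : ℕ} (h0 : LowerFormula k a l)
    (h1 : ScaleFormula k a l) {i : ℕ → ℕ} (hi : ∀ t, 1 ≤ t → t < 1 + l → 2 ≤ i t) {n : ℕ}
    (hn : 2 ≤ n) (m : ℕ) {R : List (List ℕ)} (hR : ∀ w ∈ R, w.length = 1)
    (hl : l + R.length + 1 = a.length) :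
    mergeVal k a (seg i 1 l) [n] [m] R =
      -(((n : k) - 1) * ((m : k) - 1) / ((n : k) + (m : k) - 1)) *
        ∑ t ∈ Finset.Icc 1 l, (i t : k) *
          (if seg (lower i t) 1 l ++ [n + m] :: R = a then 1 else 0)
      + ((n : k) * (m : k) / ((n : k) + (m : k) - 1)) *
        ∑ t ∈ Finset.Icc 1 l, ((i t : k) - 1) *
          (if seg i 1 l ++ [n + m - 1] :: R = a then 1 else 0)
      + ((n : k) * ((n : k) - 1) / ((n : k) + (m : k) - 1)) *
        (if seg i 1 l ++ [n + m - 1] :: R = a then 1 else 0) := by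
  rw [mergeVal_letters hn, h0 i (n + m) R hi (by omega) hR hl,
    augGam_of_length_eq_one ha (c := seg i 1 l ++ [n + m - 1] :: R) _
      (by simp [length_seg]; omega)]
  · congr 2
    rcases Nat.eq_zero_or_pos m with rfl | hm
    · simp
    · rw [h1 i (n + m - 1) R hi (by omega) hR hl]
  · intro w hw
    rcases List.mem_append.1 hw with hw | hw
    · exact length_of_mem_seg hw
    · rcases List.mem_cons.1 hw with rfl | hw
      · rfl
      · exact hR w hw

/-- Mergings in front of an adjacent normal pair contribute nothing. -/
theorem mergeVal_eq_zero (ha : IsAnickChain k a) {l : ℕ} (h0 : LowerFormula k a l)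
    (h1 : ScaleFormula k a l) {i : ℕ → ℕ} (hi : ∀ t, 1 ≤ t → t < 1 + l → 2 ≤ i t) {n : ℕ}
    (hn : 2 ≤ n) (m : ℕ) {R : List (List ℕ)} (hR : ∀ w ∈ R, w.length = 1)
    (hl : l + R.length + 1 = a.length) (hdead : ∀ v, v ++ R ≠ a) :
    mergeVal k a (seg i 1 l) [n] [m] R = 0 := by
  have hd : ∀ u w, u ++ w :: R ≠ a := fun u w h => hdead (u ++ [w]) (by simpa using h)
  rw [mergeVal_eq ha h0 h1 hi hn m hR hl]
  simp [hd]

/-- If an adjacent normal pair occurs in `x :: T`, the boundary of `[i₁|…|i_{l+1}|x|T]` only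
receives contributions from the mergings at and behind `i_{l+1}`. -/
theorem innerSum_seg_eq (ha : IsAnickChain k a) {l : ℕ} (h0 : ∀ t < l, LowerFormula k a t)
    (h1 : ∀ t < l, ScaleFormula k a t) {i : ℕ → ℕ} (hi : ∀ t, 1 ≤ t → t < 1 + (l + 1) → 2 ≤ i t)
    {x : List ℕ} {T : List (List ℕ)} (hT : ∀ w ∈ x :: T, w.length = 1)
    (hl : l + T.length + 1 = a.length) (hdead : ∀ v, v ++ x :: T ≠ a) :
    innerSum k a [] (seg i 1 (l + 1) ++ x :: T) =
      (-1) ^ l * (-mergeVal k a (seg i 1 l) [i (l + 1)] x T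
        - innerSum k a (seg i 1 (l + 1)) (x :: T)) := by
  rw [innerSum_seg, innerSum_cons_cons, Finset.sum_eq_zero, zero_add, seg_concat i 1 l,
    add_comm 1 l]
  intro t ht
  rw [Finset.mem_range] at ht
  refine mul_eq_zero_of_right _ (mergeVal_eq_zero ha (h0 t ht) (h1 t ht)
    (fun s h1 h2 => hi s h1 (by omega)) (hi _ (by omega) (by omega)) _ ?_ ?_ ?_)
  · intro w hw
    rcases List.mem_append.1 hw with hw | hw
    · exact length_of_mem_seg hw
    · exact hT w hw
  · simp [length_seg]; omega
  · intro v hv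
    rw [← List.append_assoc] at hv
    exact hdead _ hv

/-- The path sum at `[i₁|…|i_{l+1}|x y|R]`: after the splitting, only the merging of `i_{l+1}`
with `x` matters, provided that the mergings behind `x` do not. -/
theorem augGam_split_succ (ha : IsAnickChain k a) {l : ℕ} (h0 : ∀ t < l, LowerFormula k a t)
    (h1 : ∀ t < l, ScaleFormula k a t) {i : ℕ → ℕ} (hi : ∀ t, 1 ≤ t → t < 1 + (l + 1) → 2 ≤ i t)
    {x y : ℕ} (hxy : Normal k ([x] ++ [y])) {R : List (List ℕ)} (hR : ∀ w ∈ R, w.length = 1)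
    (hl : l + 1 + R.length + 1 = a.length)
    (htail : innerSum k a (seg i 1 (l + 1) ++ [[x]]) ([y] :: R) = 0) :
    augGam k a (seg i 1 (l + 1) ++ [x, y] :: R) =
      mergeVal k a (seg i 1 l) [i (l + 1)] [x] ([y] :: R) := by
  have hyR : ∀ w ∈ [y] :: R, w.length = 1 := by simpa using hR
  have hz := innerSum_of_isAnickChain ha ((isAnickChain_singleton x).seg_append hi)
    (isVertex_of_length_eq_one hyR) hxy (by rw [length_seg]; omega)
  rw [innerSum_seg_eq ha h0 h1 hi (by simpa using hR) (by simp; omega)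
    (fun v => append_ne_of_normal ha hxy v R), innerSum_cons_cons, htail,
    mergeVal_of_normal hxy] at hz
  have := (mul_eq_zero.1 hz).resolve_left (pow_ne_zero _ (neg_ne_zero.2 one_ne_zero))
  rw [List.singleton_append] at this
  linear_combination this

theorem augGam_split_zero (ha : IsAnickChain k a) {x y : ℕ} (hxy : Normal k ([x] ++ [y]))
    {R : List (List ℕ)} (hR : ∀ w ∈ R, w.length = 1) (hl : R.length + 1 = a.length)
    (htail : innerSum k a [[x]] ([y] :: R) = 0) : augGam k a ([x, y] :: R) = 0 := by
  have hyR : ∀ w ∈ [y] :: R, w.length = 1 := by simpa using hR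
  have hz := innerSum_of_isAnickChain ha (u := []) (isAnickChain_singleton x)
    (isVertex_of_length_eq_one hyR) hxy (by simp; omega)
  rw [List.nil_append, innerSum_cons_cons, List.nil_append, htail, mergeVal_of_normal hxy] at hz
  simpa using hz

/-- Everything behind a letter `0` is out of reach of the splittings. -/
theorem innerSum_zero_tail (ha : IsAnickChain k a) {u L : List (List ℕ)}
    (hu : ∀ w ∈ u, w.length = 1) (hL : IsVertex k L) (hl : u.length + L.length = a.length) :
    innerSum k a (u ++ [[0]]) L = 0 := by
  refine innerSum_eq_zero hL fun w t hwt hlen => ?_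
  rw [List.append_assoc, List.singleton_append]
  exact augGam_eq_zero_of_normal ha hu hwt (normal_zero_append (hwt w (by simp)).2)
    (by simp; omega)

theorem lowerFormula_of_lt (ha : IsAnickChain k a) {l : ℕ} (h0 : ∀ t < l, LowerFormula k a t)
    (h1 : ∀ t < l, ScaleFormula k a t) : LowerFormula k a l := by
  intro i y R hi hy hR hl
  have hyR : ∀ w ∈ [y] :: R, w.length = 1 := by simpa using hR
  have hxy : Normal k ([0] ++ [y]) := normal_zero_append (normal_of_length_le_one (by simp))
  have htail : innerSum k a (seg i 1 l ++ [[0]]) ([y] :: R) = 0 :=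
    innerSum_zero_tail ha (fun _ => length_of_mem_seg) (isVertex_of_length_eq_one hyR)
      (by simp [length_seg]; omega)
  cases l with
  | zero =>
    rw [seg_zero, List.nil_append] at *
    simpa using augGam_split_zero ha hxy hR (by omega) htail
  | succ l =>
    rw [augGam_split_succ ha (fun t ht => h0 t (by omega)) (fun t ht => h1 t (by omega)) hi hxy hR
      hl htail, mergeVal_eq ha (h0 l (by omega)) (h1 l (by omega))
      (fun t ht ht' => hi t ht (by omega)) (hi _ (by omega) (by omega)) 0 hyR (by simp; omega),
      Finset.sum_Icc_succ_top (by omega)]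
    have hi2 := hi (l + 1) (by omega) (by omega)
    have hne : (i (l + 1) : k) - 1 ≠ 0 := by
      rw [sub_ne_zero]; exact_mod_cast (by omega : i (l + 1) ≠ 1)
    have hsum : ∑ t ∈ Finset.Icc 1 l, (i t : k) *
          (if seg (lower i t) 1 (l + 1) ++ [y] :: R = a then 1 else 0)
        = ∑ t ∈ Finset.Icc 1 l, (i t : k) *
          (if seg (lower i t) 1 l ++ [i (l + 1)] :: [y] :: R = a then 1 else 0) := by
      refine Finset.sum_congr rfl fun t ht => ?_
      rw [Finset.mem_Icc] at ht
      rw [seg_concat, lower, Function.update_of_ne (by omega), add_comm 1 l, List.append_assoc,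
        List.singleton_append]
    have hlast : seg (lower i (l + 1)) 1 (l + 1) = seg i 1 l ++ [[i (l + 1) - 1]] := by
      rw [seg_concat, add_comm 1 l, lower, Function.update_self,
        seg_congr fun t _ _ => Function.update_of_ne (by omega) _ _]
    rw [hlast, hsum]
    simp only [List.append_assoc, List.singleton_append, add_zero, Nat.cast_zero, mul_zero,
      zero_div, zero_mul]
    field_simp
    ring

/-- The path sum vanishes at `[i₁|…|i_l|1|0 y|R]`. -/
theorem augGam_one_split (ha : IsAnickChain k a) {l : ℕ} (h0 : ∀ t < l, LowerFormula k a t)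
    (h1 : ∀ t < l, ScaleFormula k a t) (h0' : LowerFormula k a l) {i : ℕ → ℕ} {y : ℕ}
    {R : List (List ℕ)} (hi : ∀ t, 1 ≤ t → t < 1 + l → 2 ≤ i t) (hy : 2 ≤ y)
    (hR : ∀ w ∈ R, w.length = 1) (hl : l + 1 + R.length + 1 = a.length) :
    augGam k a (seg i 1 l ++ [1] :: [0, y] :: R) = 0 := by
  have hyR : ∀ w ∈ [y] :: R, w.length = 1 := by simpa using hR
  have h0yR : ∀ w ∈ [0] :: [y] :: R, w.length = 1 := by simpa using hR
  have hxy : Normal k ([0] ++ [y]) := normal_zero_append (normal_of_length_le_one (by simp))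
  have h1y : Normal k ([1] ++ [y]) := normal_one_pair (by omega)
  have htail : innerSum k a (seg i 1 l ++ [[1]] ++ [[0]]) ([y] :: R) = 0 := by
    refine innerSum_zero_tail ha ?_ (isVertex_of_length_eq_one hyR)
      (by simp [length_seg]; omega)
    intro w hw
    rcases List.mem_append.1 hw with hw | hw
    · exact length_of_mem_seg hw
    · simp at hw; subst hw; rfl
  have hz : innerSum k a [] (seg i 1 l ++ [1] :: [0] :: [y] :: R) = 0 := by
    have := innerSum_of_isAnickChain (u := seg i 1 l ++ [[1]]) (x := 0) ha
      (by simpa using isAnickChain_one_zero.seg_append hi)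
      (isVertex_of_length_eq_one hyR) hxy (by simp [length_seg]; omega)
    simpa using this
  -- the boundary reduces to the mergings behind `i_l`
  have hmid : innerSum k a (seg i 1 l) ([1] :: [0] :: [y] :: R) = 0 := by
    cases l with
    | zero => exact hz
    | succ l =>
      have hd : ∀ v, v ++ [0] :: [y] :: R ≠ a := fun v => append_ne_of_normal ha hxy v R
      rw [innerSum_seg_eq ha (fun t ht => h0 t (by omega)) (fun t ht => h1 t (by omega)) hi
        (by simpa using hR) (by simp; omega)
        (fun v hv => hd (v ++ [[1]]) (by simpa using hv)),
        mergeVal_eq_zero ha (h0 l (by omega)) (h1 l (by omega))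
          (fun t ht ht' => hi t ht (by omega)) (hi _ (by omega) (by omega)) 1 h0yR
          (by simp; omega) hd] at hz
      have := (mul_eq_zero.1 hz).resolve_left (pow_ne_zero _ (neg_ne_zero.2 one_ne_zero))
      linear_combination -this
  rw [innerSum_cons_cons, innerSum_cons_cons, htail, mergeVal_of_normal hxy, mergeVal_one_zero,
    h0' i 1 ([y] :: R) hi le_rfl hyR (by simp; omega),
    augGam_eq_zero_of_normal ha (fun _ => length_of_mem_seg)
      (isVertex_of_length_eq_one hyR) hxy (by simp [length_seg]; omega),
    Finset.sum_eq_zero fun t _ => by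
      rw [if_neg (append_ne_of_normal ha h1y _ R), mul_zero]] at hmid
  simpa using hmid

theorem scaleFormula_of_lt (ha : IsAnickChain k a) {l : ℕ} (h0 : ∀ t < l, LowerFormula k a t)
    (h1 : ∀ t < l, ScaleFormula k a t) (h0' : LowerFormula k a l) : ScaleFormula k a l := by
  intro i y R hi hy hR hl
  have hyR : ∀ w ∈ [y] :: R, w.length = 1 := by simpa using hR
  have hxy : Normal k ([1] ++ [y]) := normal_one_pair (by omega)
  have htail : innerSum k a (seg i 1 l ++ [[1]]) ([y] :: R) = 0 := by
    match R, hR, hl with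
    | [], _, _ => exact innerSum_singleton _ _
    | r :: R, hR, hl =>
      obtain ⟨r, rfl⟩ := List.length_eq_one_iff.1 (hR r (by simp))
      have hR' : ∀ w ∈ R, w.length = 1 := fun w hw => hR w (by simp [hw])
      have hlen : (seg i 1 l ++ [1] :: [y] :: R).length = a.length := by
        simp [length_seg] at hl ⊢; omega
      -- behind the letter `1`, only `[0, y + r]` could be split
      have hfirst : mergeVal k a (seg i 1 l ++ [[1]]) [y] [r] R = 0 := by
        rw [mergeVal_letters hy, List.append_assoc, List.singleton_append, List.append_assoc,
          List.singleton_append, List.append_assoc, List.singleton_append,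
          augGam_one_split ha h0 h1 h0' hi (by omega) hR' (by simp at hl; omega),
          augGam_eq_zero_of_normal ha (fun _ => length_of_mem_seg) (w := [1, y + r - 1]),
          augGam_eq_zero_of_normal ha (fun _ => length_of_mem_seg) (w := [y + r - 1])]
        · ring
        · exact isVertex_of_length_eq_one (by simpa using hR')
        · exact normal_one_pair (by omega)
        · simpa using hlen
        · refine IsVertex.cons.2 ⟨⟨by simp, ?_⟩, isVertex_of_length_eq_one hR'⟩
          exact normal_one_pair (by omega)
        · rw [normal_iff]
          simp [Allowed]
          omega
        · simpa using hlen
      rw [innerSum_cons_cons, hfirst, neg_zero, zero_sub, neg_eq_zero]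
      refine innerSum_eq_zero (isVertex_of_length_eq_one hR) fun w t hwt hlt => ?_
      rw [List.append_assoc, List.append_assoc, List.singleton_append, List.singleton_append]
      refine augGam_eq_zero_of_normal ha (fun _ => length_of_mem_seg)
        (IsVertex.cons.2 ⟨⟨by simp, normal_of_length_le_one (by simp)⟩, hwt⟩) hxy ?_
      simp [length_seg] at hl hlt ⊢
      omega
  cases l with
  | zero =>
    rw [seg_zero, List.nil_append] at *
    simpa using augGam_split_zero ha hxy hR (by omega) htail
  | succ l =>
    rw [augGam_split_succ ha (fun t ht => h0 t (by omega)) (fun t ht => h1 t (by omega)) hi hxy hR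
      hl htail, mergeVal_eq ha (h0 l (by omega)) (h1 l (by omega))
      (fun t ht ht' => hi t ht (by omega)) (hi _ (by omega) (by omega)) 1 hyR (by simp; omega),
      Finset.sum_Icc_succ_top (by omega)]
    have hi2 := hi (l + 1) (by omega) (by omega)
    have hne : (i (l + 1) : k) ≠ 0 := by exact_mod_cast (by omega : i (l + 1) ≠ 0)
    rw [seg_concat, add_comm 1 l]
    simp only [List.append_assoc, List.singleton_append, Nat.cast_one, sub_self, mul_zero,
      zero_div, neg_zero, zero_mul, add_sub_cancel_right, Nat.add_sub_cancel, mul_one, zero_add]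
    field_simp
    rw [add_left_inj]
    exact Finset.sum_congr rfl fun _ _ => mul_comm _ _

theorem splitFormulas (ha : IsAnickChain k a) (l : ℕ) :
    LowerFormula k a l ∧ ScaleFormula k a l := by
  induction l using Nat.strong_induction_on with
  | _ l ih =>
    have h0 := lowerFormula_of_lt ha (fun t ht => (ih t ht).1) fun t ht => (ih t ht).2
    exact ⟨h0, scaleFormula_of_lt ha (fun t ht => (ih t ht).1) (fun t ht => (ih t ht).2) h0⟩

end Formulas

/-! ### The differential in the basis of Anick chains -/

section Differential

variable {k : Type u} [Field k]

/-- A tuple of letters that is an Anick chain, as an index of the basis of `A k n`. -/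
def letterChain (n : ℕ) {i : ℕ → ℕ} (h : IsAnickChain k (letters n i)) : Chain k n :=
  ⟨letters n i, h, by simp [letters]⟩

theorem bracket_of_isAnickChain {n : ℕ} {i : ℕ → ℕ} (h : IsAnickChain k (letters n i)) :
    bracket k n i = Finsupp.single (letterChain n h) 1 := dif_pos h

theorem bracket_apply (n : ℕ) (i : ℕ → ℕ) (a : Chain k n) :
    bracket k n i a = if letters n i = a.1 then 1 else 0 := by
  classical
  by_cases h : IsAnickChain k (letters n i)
  · rw [bracket_of_isAnickChain h, Finsupp.single_apply]
    exact if_congr ⟨fun h' => congrArg Subtype.val h', fun h' => Subtype.ext h'⟩ rfl rfl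
  · have hne : letters n i ≠ a.1 := fun h' => h (h'.symm ▸ a.2.1)
    rw [if_neg hne, bracket, dif_neg h]
    rfl

theorem sum_range_eq_sum_Icc (f : ℕ → k) (m : ℕ) :
    ∑ t ∈ Finset.range m, f (t + 1) = ∑ j ∈ Finset.Icc 1 m, f j := by
  induction m with
  | zero => simp
  | succ m ih => rw [Finset.sum_range_succ, ih, Finset.sum_Icc_succ_top (by omega)]

theorem sum_Icc_two_eq {M : Type*} [AddCommMonoid M] {f : ℕ → M} (h : f 1 = 0) (m : ℕ) :
    ∑ j ∈ Finset.Icc 2 m, f j = ∑ j ∈ Finset.Icc 1 m, f j := by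
  refine Finset.sum_subset (Finset.Icc_subset_Icc_left (by omega)) fun j hj hj' => ?_
  rw [Finset.mem_Icc] at hj hj'
  rw [show j = 1 by omega, h]

theorem seg_shift {f i : ℕ → ℕ} {s l : ℕ} (h : ∀ t, s ≤ t → f t = i (t + 1)) :
    seg f s l = seg i (s + 1) l := by
  induction l generalizing s with
  | zero => rfl
  | succ l ih => rw [seg_succ, seg_succ, h s le_rfl, ih fun t ht => h t (by omega)]

theorem letters_eq_append {n j x : ℕ} (hj : 1 ≤ j) (hjn : j ≤ n) {f g i : ℕ → ℕ}
    (h1 : ∀ t, 1 ≤ t → t < j → f t = g t) (h2 : f j = x) (h3 : ∀ t, j < t → f t = i (t + 1)) :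
    letters n f = seg g 1 (j - 1) ++ [x] :: seg i (j + 2) (n - j) := by
  have h : seg f (j + 1) (n - j) = seg i (j + 2) (n - j) := seg_shift fun t ht => h3 t ht
  obtain ⟨j, rfl⟩ : ∃ d, j = d + 1 := ⟨j - 1, by omega⟩
  rw [letters_eq_seg, show n = j + (n - (j + 1) + 1) by omega, ← seg_append, seg_succ,
    add_comm 1 j, h2, show j + (n - (j + 1) + 1) - (j + 1) = n - (j + 1) by omega, h,
    seg_congr fun t ht ht' => h1 t ht (by omega)]
  rfl

theorem letters_merge {n j x : ℕ} (hj : 1 ≤ j) (hjn : j ≤ n) (i : ℕ → ℕ) :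
    letters n (merge i j x) = seg i 1 (j - 1) ++ [x] :: seg i (j + 2) (n - j) := by
  refine letters_eq_append hj hjn (fun t _ ht => ?_) ?_ fun t ht => ?_
  · rw [merge, if_pos ht]
  · rw [merge, if_neg (lt_irrefl j), if_pos rfl]
  · rw [merge, if_neg (by omega), if_neg (by omega)]

theorem letters_lower_merge {n j t x : ℕ} (ht : t < j) (hj : 1 ≤ j) (hjn : j ≤ n) (i : ℕ → ℕ) :
    letters n (lower (merge i j x) t)
      = seg (lower i t) 1 (j - 1) ++ [x] :: seg i (j + 2) (n - j) := by
  refine letters_eq_append hj hjn (fun s _ hs => ?_) ?_ fun s hs => ?_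
  · rcases eq_or_ne s t with rfl | hst
    · simp [lower, merge, hs]
    · simp [lower, merge, hs, hst]
  · rw [lower, Function.update_of_ne (by omega), merge, if_neg (lt_irrefl j), if_pos rfl]
  · rw [lower, Function.update_of_ne (by omega), merge, if_neg (by omega), if_neg (by omega)]

variable [CharZero k]

theorem anickResD_apply (n : ℕ) (b : Chain k (n + 1)) (a : Chain k n) :
    anickResD k n b a = Gam k b.1 a.1 := by
  classical
  have hfin : (Function.support fun a : Chain k n => Finsupp.single a (Gam k b.1 a.1)).Finite := by
    refine Set.Finite.of_finite_image (f := Subtype.val) ?_ Subtype.val_injective.injOn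
    refine ((finite_setOf_isPath b.2.1.isVertex).image fun l => l.getLastD b.1).subset ?_
    rintro _ ⟨c, hc, rfl⟩
    by_contra hno
    refine hc ?_
    have : Gam k b.1 c.1 = 0 := by
      rw [Gam]
      refine finsum_mem_eq_zero_of_forall_eq_zero fun l hl => ?_
      exact absurd ⟨l, hl.1, hl.2⟩ hno
    simp [this]
  rw [anickResD, finsum_eq_sum _ hfin, Finsupp.finsetSum_apply]
  simp only [Finsupp.single_apply, Finset.sum_ite_eq']
  split_ifs with h
  · rfl
  · simp only [Set.Finite.mem_toFinset, Function.mem_support, not_not] at h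
    rw [Finsupp.single_eq_zero] at h
    exact h.symm

theorem anickD_bracket_apply (n : ℕ) {i : ℕ → ℕ} (h : IsAnickChain k (letters (n + 1) i))
    (a : Chain k n) :
    anickD k n (bracket k (n + 1) i) a = augGam k a.1 (letters (n + 1) i) := by
  rw [bracket_of_isAnickChain h, anickD, Finsupp.linearCombination_single, one_smul,
    Finsupp.mapRange_apply, anickResD_apply]
  rfl

/-- The boundary of a critical tuple of letters, as a sum over the merged pairs. -/
theorem augGam_letters {n : ℕ} {i : ℕ → ℕ} (h : IsAnickChain k (letters (n + 1) i))
    (a : Chain k n) :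
    augGam k a.1 (letters (n + 1) i) = ∑ t ∈ Finset.range n, (-1) ^ (t + 1) *
        mergeVal k a.1 (seg i 1 t) [i (t + 1)] [i (t + 2)] (seg i (t + 3) (n - 1 - t)) := by
  have hlen : (letters (n + 1) i).length = a.1.length + 1 := by
    rw [a.2.2]; simp [letters]
  have := innerSum_seg (k := k) a.1 i n []
  rw [augGam_of_isAnickChain h hlen, ← innerSum_nil, letters_eq_seg]
  simpa [innerSum_singleton] using this

/-- The three sums collect the contributions of the first `m` mergings. -/
theorem mergeSums_apply {n m : ℕ} (hm : m ≤ n) {i : ℕ → ℕ} (hi : ∀ s ∈ Finset.Icc 1 m, 2 ≤ i s)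
    (a : Chain k n) :
    mergeSums k n m i a = ∑ t ∈ Finset.range m, (-1) ^ (t + 1) *
        mergeVal k a.1 (seg i 1 t) [i (t + 1)] [i (t + 2)] (seg i (t + 3) (n - 1 - t)) := by
  have h := sum_range_eq_sum_Icc (k := k) (fun j => (-1) ^ j *
        mergeVal k a.1 (seg i 1 (j - 1)) [i j] [i (j + 1)] (seg i (j + 2) (n - j))) m
  have h' : ∀ t ∈ Finset.range m, (-1 : k) ^ (t + 1) *
        mergeVal k a.1 (seg i 1 t) [i (t + 1)] [i (t + 2)] (seg i (t + 3) (n - 1 - t))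
      = (-1) ^ (t + 1) * mergeVal k a.1 (seg i 1 (t + 1 - 1)) [i (t + 1)] [i (t + 1 + 1)]
        (seg i (t + 1 + 2) (n - (t + 1))) := by
    intro t _
    rw [Nat.add_sub_cancel, Nat.sub_sub, add_comm 1 t]
  rw [Finset.sum_congr rfl h', h, mergeSums, sum_Icc_two_eq (by simp), sum_Icc_two_eq (by simp),
    ← Finset.sum_sub_distrib, ← Finset.sum_add_distrib, Finsupp.finsetSum_apply]
  refine Finset.sum_congr rfl fun j hj => ?_
  have hj' := Finset.mem_Icc.1 hj
  obtain ⟨h0, h1⟩ := splitFormulas a.2.1 (j - 1)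
  rw [mergeVal_eq a.2.1 h0 h1 (fun t ht ht' => hi t (Finset.mem_Icc.2 ⟨ht, by omega⟩)) (hi j hj) _
    (fun _ => length_of_mem_seg) (by rw [length_seg, a.2.2]; omega)]
  have e1 : ∀ t ∈ Finset.Icc 1 (j - 1), bracket k n (lower (merge i j (i j + i (j + 1))) t) a
      = if seg (lower i t) 1 (j - 1) ++ [i j + i (j + 1)] :: seg i (j + 2) (n - j) = a.1
        then 1 else 0 := by
    intro t ht
    rw [Finset.mem_Icc] at ht
    rw [bracket_apply, letters_lower_merge (by omega) hj'.1 (by omega)]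
  simp only [Finsupp.add_apply, Finsupp.sub_apply, Finsupp.finsetSum_apply, Finsupp.smul_apply,
    smul_eq_mul]
  rw [Finset.sum_congr rfl fun t ht => by rw [e1 t ht]]
  simp only [bracket_apply, letters_merge hj'.1 (show j ≤ n by omega)]
  rw [mul_add, mul_add, Finset.mul_sum, Finset.mul_sum, Finset.mul_sum, Finset.mul_sum,
    sub_eq_add_neg, ← Finset.sum_neg_distrib]
  -- the three sums occur in a different order on the two sides
  have e2 : ∀ x y z x' y' z' : k, x = z' → y = x' → z = y' → x + y + z = x' + y' + z' := by
    rintro x y z x' y' z' rfl rfl rfl; ring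
  refine e2 _ _ _ _ _ _ ?_ (Finset.sum_congr rfl fun t _ => ?_)
    (Finset.sum_congr rfl fun t _ => ?_) <;> ring

/-- The Anick chains with at least two entries. -/
theorem isAnickChain_and_length_iff {n : ℕ} (hn : 1 ≤ n) (b : List (List ℕ)) :
    (IsAnickChain k b ∧ b.length = n + 1) ↔
      ∃ i : ℕ → ℕ, b = letters (n + 1) i ∧ (∀ s ∈ Finset.Icc 1 (n - 1), 2 ≤ i s) ∧
        (2 ≤ i n ∨ (i n = 1 ∧ i (n + 1) = 0)) := by
  constructor
  · rintro ⟨hb, hl⟩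
    obtain ⟨js, rfl, hjs⟩ := isAnickChain_iff.1 hb
    rw [List.length_map] at hl
    have hpair : ∀ s, 1 ≤ s → s ≤ n → 2 ≤ js.getD (s - 1) 0 ∨
        (js.getD (s - 1) 0 = 1 ∧ js.getD (s + 1 - 1) 0 = 0) := by
      intro s hs hsn
      rw [← not_allowed_iff, List.getD_eq_getElem _ _ (by omega),
        List.getD_eq_getElem _ _ (by omega)]
      have := List.isChain_iff_getElem.1 hjs (s - 1) (by omega)
      simpa only [Nat.sub_add_cancel hs, Nat.add_sub_cancel] using this
    refine ⟨fun s => js.getD (s - 1) 0, ?_, ?_, hpair n hn le_rfl⟩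
    · refine List.ext_getElem (by simp [letters, hl]) fun t h1 h2 => ?_
      simp only [List.length_map] at h1
      simp [letters, h1]
    · intro s hs
      rw [Finset.mem_Icc] at hs
      rcases hpair s hs.1 (by omega) with h | ⟨-, h⟩
      · exact h
      · rcases hpair (s + 1) (by omega) (by omega) with h' | ⟨h', -⟩ <;> omega
  · rintro ⟨i, rfl, hi, hin⟩
    refine ⟨?_, by simp [letters]⟩
    have hpair : IsAnickChain k [[i n], [i (n + 1)]] := by
      rcases hin with h | ⟨h, h'⟩
      · exact (isAnickChain_singleton _).cons h
      · rw [h, h']; exact isAnickChain_one_zero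
    have := hpair.seg_append (i := i) (s := 1) (l := n - 1)
      fun t ht ht' => hi t (Finset.mem_Icc.2 ⟨ht, by omega⟩)
    rw [letters_eq_seg]
    obtain ⟨n, rfl⟩ : ∃ d, n = d + 1 := ⟨n - 1, by omega⟩
    rw [seg_concat, seg_concat, List.append_assoc, add_comm 1 n, add_comm 1 (n + 1)]
    exact this

/-- The differential of `[i₁|…|i_{n-1}|1|0]` beyond the mergings of letters `≥ 2`. -/
theorem augGam_letters_one_zero {n : ℕ} (hn : 1 ≤ n) {i : ℕ → ℕ}
    (hi : ∀ s ∈ Finset.Icc 1 (n - 1), 2 ≤ i s) (h1 : i n = 1) (h0 : i (n + 1) = 0)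
    (a : Chain k n) :
    augGam k a.1 (letters (n + 1) i) = (mergeSums k n (n - 2) i
        + ∑ j ∈ Finset.Icc 1 (n - 1), ((-1 : k) ^ n * (i j : k)) • bracket k n (lower i j)
        + ∑ j ∈ Finset.Icc 1 (n - 1),
            ((-1 : k) ^ (n - 1) * ((i j : k) - 1)) • bracket k n (Function.update i n 0)
        + (-1 : k) ^ n • bracket k n (Function.update i n 0)) a := by
  have hch := ((isAnickChain_and_length_iff (k := k) hn (letters (n + 1) i)).2
    ⟨i, rfl, hi, Or.inr ⟨h1, h0⟩⟩).1
  rw [augGam_letters hch]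
  have hup : letters n (Function.update i n 0) = seg i 1 (n - 1) ++ [[0]] := by
    rw [letters_eq_append hn le_rfl (x := 0) (g := i) (i := fun t => Function.update i n 0 (t - 1))
      (fun t _ ht => Function.update_of_ne (by omega) _ _) (Function.update_self _ _ _)
      (fun t _ => rfl), Nat.sub_self, seg_zero]
  have hlow : ∀ j ∈ Finset.Icc 1 (n - 1),
      letters n (lower i j) = seg (lower i j) 1 (n - 1) ++ [[1]] := by
    intro j hj
    rw [Finset.mem_Icc] at hj
    rw [letters_eq_append hn le_rfl (x := 1) (g := lower i j) (i := fun t => lower i j (t - 1))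
      (fun t _ _ => rfl) (by rw [lower, Function.update_of_ne (by omega), h1])
      (fun t _ => rfl), Nat.sub_self, seg_zero]
  simp only [Finsupp.add_apply, Finsupp.finsetSum_apply, Finsupp.smul_apply, smul_eq_mul,
    bracket_apply, hup]
  have hlow' : ∑ j ∈ Finset.Icc 1 (n - 1), (-1 : k) ^ n * (i j : k) *
        (if letters n (lower i j) = a.1 then 1 else 0)
      = (-1) ^ n * ∑ j ∈ Finset.Icc 1 (n - 1), (i j : k) *
        (if seg (lower i j) 1 (n - 1) ++ [[1]] = a.1 then 1 else 0) := by
    rw [Finset.mul_sum]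
    refine Finset.sum_congr rfl fun j hj => ?_
    rw [hlow j hj, mul_assoc]
  rw [hlow', mergeSums_apply (by omega) (fun s hs => hi s (Finset.mem_Icc.2
    ⟨(Finset.mem_Icc.1 hs).1, by have := (Finset.mem_Icc.1 hs).2; omega⟩))]
  obtain ⟨m, rfl⟩ : ∃ m, n = m + 1 := ⟨n - 1, by omega⟩
  rw [Nat.add_sub_cancel] at *
  have hi' : ∀ t, 1 ≤ t → t < 1 + m → 2 ≤ i t :=
    fun t ht ht' => hi t (Finset.mem_Icc.2 ⟨ht, by omega⟩)
  -- the merging of `1` and `0`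
  have hlast : mergeVal k a.1 (seg i 1 m) [i (m + 1)] [i (m + 2)]
        (seg i (m + 3) (m - m))
      = ∑ j ∈ Finset.Icc 1 m, (i j : k) *
          (if seg (lower i j) 1 m ++ [[1]] = a.1 then 1 else 0)
        + if seg i 1 m ++ [[0]] = a.1 then 1 else 0 := by
    rw [h1, h0, Nat.sub_self, seg_zero, mergeVal_one_zero,
      (splitFormulas a.2.1 m).1 i 1 [] hi' le_rfl (by simp) (by simp [a.2.2]), augGam_of_length_eq_one a.2.1]
    · intro w hw
      rcases List.mem_append.1 hw with hw | hw
      · exact length_of_mem_seg hw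
      · simp at hw; subst hw; rfl
    · simp [length_seg, a.2.2]
  rw [Finset.sum_range_succ, hlast]
  cases m with
  | zero => simp
  | succ m =>
    -- the merging of `i_{n-1}` and `1`
    have hprev : mergeVal k a.1 (seg i 1 m) [i (m + 1)] [i (m + 2)]
          (seg i (m + 3) (m + 1 - m))
        = ∑ j ∈ Finset.Icc 1 (m + 1), ((i j : k) - 1) *
            (if seg i 1 (m + 1) ++ [[0]] = a.1 then 1 else 0) := by
      have hi2 := hi' (m + 1) (by omega) (by omega)
      have hne : (i (m + 1) : k) ≠ 0 := by exact_mod_cast (by omega : i (m + 1) ≠ 0)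
      rw [h1, Nat.add_sub_cancel_left, seg_succ, seg_zero, h0,
        mergeVal_eq a.2.1 (splitFormulas a.2.1 m).1 (splitFormulas a.2.1 m).2
          (fun t ht ht' => hi' t ht (by omega)) hi2 1 (by simp) (by simp [a.2.2]),
        Finset.sum_Icc_succ_top (by omega), seg_concat, add_comm 1 m]
      simp only [List.append_assoc, List.singleton_append, Nat.cast_one, sub_self, mul_zero,
        zero_div, neg_zero, zero_mul, add_sub_cancel_right, Nat.add_sub_cancel, mul_one, zero_add]
      rw [div_self hne, one_mul, mul_div_cancel_left₀ _ hne]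
    rw [Finset.sum_range_succ, hprev, show m + 1 + 1 - 2 = m by omega]
    simp only [mul_assoc, ← Finset.mul_sum]
    ring

end Differential

end AnickU3

theorem mainTheorem2 (k : Type*) [Field k] [CharZero k] (n : ℕ) (hn : 1 ≤ n) :
    -- only finitely many paths of the Morse graph start at a given Anick chain
    (∀ b : List (List ℕ), AnickU3.IsAnickChain k b →
      {l | AnickU3.IsPath k b l}.Finite) ∧
    -- the Anick chains with `n + 1` entries
    (∀ b : List (List ℕ), (AnickU3.IsAnickChain k b ∧ b.length = n + 1) ↔
      ∃ i : ℕ → ℕ, b = AnickU3.letters (n + 1) i ∧ (∀ s ∈ Finset.Icc 1 (n - 1), 2 ≤ i s) ∧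
        (2 ≤ i n ∨ (i n = 1 ∧ i (n + 1) = 0))) ∧
    -- the differential on the chains with `i_n ≥ 2`
    (∀ i : ℕ → ℕ, (∀ s ∈ Finset.Icc 1 n, 2 ≤ i s) →
      AnickU3.anickD k n (AnickU3.bracket k (n + 1) i) = AnickU3.mergeSums k n n i) ∧
    -- the differential on the chains `[i_1|…|i_{n-1}|1|0]`
    (∀ i : ℕ → ℕ, (∀ s ∈ Finset.Icc 1 (n - 1), 2 ≤ i s) → i n = 1 → i (n + 1) = 0 →
      AnickU3.anickD k n (AnickU3.bracket k (n + 1) i) =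
        AnickU3.mergeSums k n (n - 2) i
        + ∑ j ∈ Finset.Icc 1 (n - 1),
            ((-1 : k) ^ n * (i j : k)) • AnickU3.bracket k n (AnickU3.lower i j)
        + ∑ j ∈ Finset.Icc 1 (n - 1),
            ((-1 : k) ^ (n - 1) * ((i j : k) - 1)) •
              AnickU3.bracket k n (Function.update i n 0)
        + (-1 : k) ^ n • AnickU3.bracket k n (Function.update i n 0)) := by
  refine ⟨fun b hb => AnickU3.finite_setOf_isPath hb.isVertex,
    AnickU3.isAnickChain_and_length_iff hn, fun i hi => ?_, fun i hi h1 h0 => ?_⟩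
  · have hi' : ∀ s ∈ Finset.Icc 1 (n - 1), 2 ≤ i s := fun s hs =>
      hi s (Finset.Icc_subset_Icc_right (Nat.sub_le n 1) hs)
    have hch := ((AnickU3.isAnickChain_and_length_iff (k := k) hn
      (AnickU3.letters (n + 1) i)).2
      ⟨i, rfl, hi', Or.inl (hi n (Finset.right_mem_Icc.2 hn))⟩).1
    ext a
    rw [AnickU3.anickD_bracket_apply n hch, AnickU3.augGam_letters hch,
      AnickU3.mergeSums_apply le_rfl hi]
  · have hch := ((AnickU3.isAnickChain_and_length_iff (k := k) hn
      (AnickU3.letters (n + 1) i)).2 ⟨i, rfl, hi, Or.inr ⟨h1, h0⟩⟩).1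
    ext a
    rw [AnickU3.anickD_bracket_apply n hch, AnickU3.augGam_letters_one_zero hn hi h1 h0]
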